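/- Let $\delta>0$, $t_0\in\mathbb R$, $\phi(\xi)=\xi/\sqrt{1-\xi^2}$ for $|\xi|<1$. Let $q:\mathbb R\to\mathbb R$ with $q\in L^\infty(t_0,+\infty)$, and assume that there are $\eta>0$ and $c>0$ such that $q(t)\ge\eta$ for almost every $t\in\,]t_0,+\infty[$ and $q= c$ (almost everywhere) on $]-\infty,t_0]$. Let $f:[0,1]\to\mathbb R$ be Lipschitz continuous and bistable, that is, $f(0)=f(\alpha)=f(1)=0$ for some $\alpha\in\,]0,1[$, $f<0$ on $]0,\alpha[$ and $f>0$ on $]\alpha,1[$. Put $F(v)=\int_0^v f(s)\,ds$ and assume $F(1)>0$. If $$c\;\ge\;\|q\|_{L^\infty(t_0,+\infty)}\,\frac{F(1)-F(\alpha)}{-F(\alpha)},\qquad(\ast)$$ then the equation $$\delta\bigl(\phi(v')\bigr)'+q(t)f(v)=0,\qquad t\in\mathbb R,$$ has a strictly increasing heteroclinic solution $v$, that is, a strictly increasing $C^1$ function $v:\mathbb R\to[0,1]$ with $|v'|<1$ and $v'$ absolutely continuous on compact intervals, which satisfies the equation almost everywhere and $v(t)\to0$ as $t\to-\infty$, $v(t)\to1$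 as $t\to+\infty$. Moreover, $v$ can be chosen with $v(t_0)\in[\alpha,1[$, and even $v(t_0)\in\,]\alpha,1[$ unless equality holds in $(\ast)$ and $q=\|q\|_{L^\infty(t_0,+\infty)}$ almost everywhere on $]t_0,+\infty[$. -/

import Mathlib

open MeasureTheory Set Filter Topology
open scoped NNReal ENNReal

/-- The Minkowski-curvature (Born–Infeld) function `φ(ξ) = ξ / √(1 - ξ²)`, meaningful for
`|ξ| < 1`. -/
noncomputable def minkowskiPhi (ξ : ℝ) : ℝ := ξ / √(1 - ξ ^ 2)

/-- The primitive `F(v) = ∫₀ᵛ f(s) ds`. -/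
noncomputable def primitiveF (f : ℝ → ℝ) (v : ℝ) : ℝ := ∫ s in (0 : ℝ)..v, f s

/-- The sign condition on `f : [0,1] → ℝ` with interior zeros `α ≤ β`. Only the values of `f` on
`[0,1]` are involved. -/
structure SignCondition (f : ℝ → ℝ) (α β : ℝ) : Prop where
  zero_left : f 0 = 0
  zero_right : f 1 = 0
  alpha_mem : α ∈ Ioo (0 : ℝ) 1
  beta_mem : β ∈ Ioo (0 : ℝ) 1
  alpha_le_beta : α ≤ β
  zero_alpha : f α = 0
  zero_beta : f β = 0
  neg : ∀ s ∈ Ioo 0 α, f s < 0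
  pos : ∀ s ∈ Ioo β 1, 0 < f s

/-- `f` is bistable with intermediate zero `α`: the sign condition holds with `α = β`. -/
def IsBistable (f : ℝ → ℝ) (α : ℝ) : Prop := SignCondition f α α

/-- `v : ℝ → [0,1]` solves `δ (φ(v'))' + q(t) f(v) = 0` on `ℝ`: `v` is continuously
differentiable with `|v'| < 1`, `v'` is absolutely continuous (on every compact interval), and the
equation holds almost everywhere. -/
structure IsMinkowskiSolution (δ : ℝ) (q f v : ℝ → ℝ) : Prop where
  mem_Icc : ∀ t, v t ∈ Icc (0 : ℝ) 1
  contDiff : ContDiff ℝ 1 v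
  abs_deriv_lt_one : ∀ t, |deriv v t| < 1
  absolutelyContinuous_deriv : ∀ a b : ℝ, AbsolutelyContinuousOnInterval (deriv v) a b
  equation : ∀ᵐ t : ℝ, DifferentiableAt ℝ (fun s => minkowskiPhi (deriv v s)) t ∧
    δ * deriv (fun s => minkowskiPhi (deriv v s)) t + q t * f (v t) = 0

/-- A (strictly increasing) heteroclinic solution, connecting `0` at `-∞` to `1` at `+∞`. -/
structure IsHeteroclinicSolution (δ : ℝ) (q f v : ℝ → ℝ) : Prop where
  isSolution : IsMinkowskiSolution δ q f v
  strictMono : StrictMono v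
  tendsto_atBot : Tendsto v atBot (𝓝 0)
  tendsto_atTop : Tendsto v atTop (𝓝 1)

/-- The norm `‖q‖_{L^∞(t₀,+∞)}` as a real number (meaningful for `q ∈ L^∞(t₀,+∞)`). -/
noncomputable def linftyNormRight (q : ℝ → ℝ) (t₀ : ℝ) : ℝ :=
  (eLpNorm q ∞ (volume.restrict (Ioi t₀))).toReal

/-! With the momentum `u = φ(v')` the equation becomes the planar system `v' = ψ(u)`, `u' = -q
f(v)/δ`, where `ψ = φ⁻¹` is bounded and Lipschitz. Solutions are global integral curves, since `q`
is merely measurable on the right.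

For `t ≤ t₀` the energy `√(1+u²) - 1 + (c/δ) F(v)` is conserved. Let `γ` in `]α, 1[` be the zero of
`F`. Every point of the level `0` with `0 < v < γ`, `u > 0` flows back to the equilibrium `(0,0)` as
`t → -∞` (`tendsto_atBot_of_energy_eq_zero`). It remains to choose the point `v(t₀) = x` in `[α, γ[`
on this curve so that the forward solution tends to `(1,0)`.

For `t > t₀`, cutting `f` off below `α` makes the force one-signed, so `u` is nonincreasing. Writing
`M` for `‖q‖/δ` and `Γ` for the integral of `f` from `α`, the modified energy `√(1+u²) - 1 + M Γ(v)`
is nondecreasing while `u ≥ 0`. For `x = α`, condition (∗) says exactly that this energy starts at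
or above its value `M Γ(1)` at `(1,0)`, so `u` never becomes negative. For `x = γ` the start is at
rest and `u` becomes negative at once. Turning back is an open condition on `x`; at the largest `x`
that does not turn back the solution cannot overshoot `1` either, because overshooting is also open
and excludes turning back (`exists_trapped`). Such a trapped solution converges to `(1,0)`
(`tendsto_of_le_one`) and never feels the truncation.

If the chosen `x` is `α`, the monotone modified energy starts at least at its limit, hence is
constant; this forces equality in (∗) and `q = ‖q‖` almost everywhere on the right (`rigidity`). -/

section Caratheodory

/-! ### Global Carathéodory theory in an exponentially weighted norm. -/

variable {E : Type*} [NormedAddCommGroup E]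

/-- A bounded vector field, Lipschitz in space and measurable in time along continuous curves. -/
structure IsCaratheodoryField (X : ℝ → E → E) (C : ℝ) (K : ℝ≥0) : Prop where
  norm_le : ∀ t z, ‖X t z‖ ≤ C
  lipschitz : ∀ t, LipschitzWith K (X t)
  aestronglyMeasurable : ∀ z : ℝ → E, Continuous z →
    AEStronglyMeasurable (fun s => X s (z s)) volume

theorem IsCaratheodoryField.intervalIntegrable {X : ℝ → E → E} {C : ℝ} {K : ℝ≥0}
    (hX : IsCaratheodoryField X C K) {z : ℝ → E} (hz : Continuous z)
    (a b : ℝ) : IntervalIntegrable (fun s => X s (z s)) volume a b :=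
  (intervalIntegrable_const (c := C)).mono_fun (hX.aestronglyMeasurable z hz).restrict
    (ae_of_all _ fun s => (hX.norm_le s _).trans (le_abs_self C))

variable [NormedSpace ℝ E]

/-- A continuous curve satisfying the integral form of `z' = X t z`. -/
structure IsCaratheodorySolution (X : ℝ → E → E) (z : ℝ → E) : Prop where
  continuous : Continuous z
  sub_eq_integral : ∀ a b, z b - z a = ∫ s in a..b, X s (z s)

theorem abs_integral_exp_mul_abs_le {l : ℝ} (hl : 0 < l) (τ t : ℝ) :
    |∫ s in τ..t, Real.exp (l * |s - τ|)| ≤ Real.exp (l * |t - τ|) / l := by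
  rcases le_total τ t with h | h
  · have h1 : ∫ s in τ..t, Real.exp (l * |s - τ|) = ∫ s in τ..t, Real.exp (l * (s - τ)) := by
      refine intervalIntegral.integral_congr fun s hs => ?_
      rw [uIcc_of_le h] at hs
      simp only [abs_of_nonneg (sub_nonneg.2 hs.1)]
    have h2 : ∫ s in τ..t, Real.exp (l * (s - τ)) =
        Real.exp (l * (t - τ)) / l - Real.exp (l * (τ - τ)) / l := by
      refine intervalIntegral.integral_eq_sub_of_hasDerivAt
        (f := fun s => Real.exp (l * (s - τ)) / l) (fun s _ => ?_) ?_
      · have := ((((hasDerivAt_id s).sub_const τ).const_mul l).exp).div_const l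
        convert! this using 1
        field_simp
        simp
      · exact Continuous.intervalIntegrable (by fun_prop) _ _
    have h3 : 1 ≤ Real.exp (l * (t - τ)) :=
      Real.one_le_exp (mul_nonneg hl.le (sub_nonneg.2 h))
    rw [h1, h2, abs_of_nonneg (sub_nonneg.2 h), sub_self, mul_zero, Real.exp_zero, ← sub_div,
      abs_of_nonneg (div_nonneg (by linarith) hl.le)]
    gcongr
    linarith
  · have h1 : ∫ s in τ..t, Real.exp (l * |s - τ|) = ∫ s in τ..t, Real.exp (l * (τ - s)) := by
      refine intervalIntegral.integral_congr fun s hs => ?_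
      rw [uIcc_of_ge h] at hs
      simp only [abs_of_nonpos (sub_nonpos.2 hs.2), neg_sub]
    have h2 : ∫ s in τ..t, Real.exp (l * (τ - s)) =
        -Real.exp (l * (τ - t)) / l - -Real.exp (l * (τ - τ)) / l := by
      refine intervalIntegral.integral_eq_sub_of_hasDerivAt
        (f := fun s => -Real.exp (l * (τ - s)) / l) (fun s _ => ?_) ?_
      · have := ((((hasDerivAt_id s).const_sub τ).const_mul l).exp).neg.div_const l
        convert! this using 1
        field_simp
        simp
      · exact Continuous.intervalIntegrable (by fun_prop) _ _
    have h3 : 1 ≤ Real.exp (l * (τ - t)) :=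
      Real.one_le_exp (mul_nonneg hl.le (sub_nonneg.2 h))
    rw [h1, h2, abs_of_nonpos (sub_nonpos.2 h), neg_sub, sub_self, mul_zero, Real.exp_zero,
      ← sub_div, abs_of_nonpos (div_nonpos_of_nonpos_of_nonneg (by linarith) hl.le), ← neg_div]
    gcongr
    linarith

namespace IsCaratheodoryField

variable {X : ℝ → E → E} {C : ℝ} {K : ℝ≥0}

theorem norm_integral_le (hX : IsCaratheodoryField X C K) (z : ℝ → E) (a b : ℝ) :
    ‖∫ s in a..b, X s (z s)‖ ≤ C * |b - a| :=
  intervalIntegral.norm_integral_le_of_norm_le_const fun s _ => hX.norm_le s _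

/-- Integrating the weight of rate `2K` gains `1/(2K)`, which beats the Lipschitz constant `K` and
leaves the factor `1/2`. This one estimate yields both continuous dependence and the Picard
contraction on the whole line. -/
theorem norm_integral_sub_le (hX : IsCaratheodoryField X C K) (hK : 0 < K) {z w : ℝ → E}
    (hz : Continuous z) (hw : Continuous w) {S τ : ℝ} (hS : 0 ≤ S)
    (h : ∀ s, ‖z s - w s‖ ≤ S * Real.exp (2 * K * |s - τ|)) (t : ℝ) :
    ‖(∫ s in τ..t, X s (z s)) - ∫ s in τ..t, X s (w s)‖ ≤
      S / 2 * Real.exp (2 * K * |t - τ|) := by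
  have hK' : (0 : ℝ) < K := hK
  rw [← intervalIntegral.integral_sub (hX.intervalIntegrable hz _ _)
    (hX.intervalIntegrable hw _ _)]
  have h1 : ‖∫ s in τ..t, X s (z s) - X s (w s)‖ ≤
      |∫ s in τ..t, K * S * Real.exp (2 * K * |s - τ|)| := by
    refine intervalIntegral.norm_integral_le_abs_of_norm_le (ae_of_all _ fun s => ?_)
      (Continuous.intervalIntegrable (by fun_prop) _ _)
    calc ‖X s (z s) - X s (w s)‖ ≤ K * ‖z s - w s‖ := (hX.lipschitz s).norm_sub_le _ _
      _ ≤ K * (S * Real.exp (2 * K * |s - τ|)) := by gcongr; exact h s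
      _ = _ := by ring
  refine h1.trans ?_
  rw [intervalIntegral.integral_const_mul, abs_mul, abs_of_nonneg (by positivity)]
  calc K * S * |∫ s in τ..t, Real.exp (2 * K * |s - τ|)|
      ≤ K * S * (Real.exp (2 * K * |t - τ|) / (2 * K)) := by
        gcongr
        exact abs_integral_exp_mul_abs_le (by positivity) τ t
    _ = _ := by field_simp

/-- Continuous dependence on the initial value. -/
theorem norm_sub_le (hX : IsCaratheodoryField X C K) (hK : 0 < K) {z w : ℝ → E}
    (hz : IsCaratheodorySolution X z) (hw : IsCaratheodorySolution X w) (τ t : ℝ) :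
    ‖z t - w t‖ ≤ 2 * ‖z τ - w τ‖ * Real.exp (2 * K * |t - τ|) := by
  have hK' : (0 : ℝ) < K := hK
  have hC : 0 ≤ C := (norm_nonneg _).trans (hX.norm_le 0 0)
  set D := ‖z τ - w τ‖ with hD
  have hsplit : ∀ s, z s - w s = (z τ - w τ) +
      ((∫ r in τ..s, X r (z r)) - ∫ r in τ..s, X r (w r)) := by
    intro s
    rw [← hz.sub_eq_integral, ← hw.sub_eq_integral]
    abel
  -- The difference grows at most linearly, so its weighted supremum `S` is finite; then `S ≤ D +
  -- S/2` gives `S ≤ 2D`.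
  let R : ℝ → ℝ := fun s => ‖z s - w s‖ * Real.exp (-(2 * K * |s - τ|))
  have hRb : BddAbove (range R) := by
    refine ⟨D + C / K, ?_⟩
    rintro _ ⟨s, rfl⟩
    have h1 : ‖z s - w s‖ ≤ D + 2 * C * |s - τ| := by
      rw [hsplit s]
      refine (norm_add_le _ _).trans ?_
      have := _root_.norm_sub_le (∫ r in τ..s, X r (z r)) (∫ r in τ..s, X r (w r))
      have := hX.norm_integral_le z τ s
      have := hX.norm_integral_le w τ s
      linarith
    have h2 : 2 * K * |s - τ| ≤ Real.exp (2 * K * |s - τ|) := by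
      linarith [Real.add_one_le_exp (2 * K * |s - τ|)]
    have h3 : 1 ≤ Real.exp (2 * K * |s - τ|) := Real.one_le_exp (by positivity)
    change ‖z s - w s‖ * Real.exp (-(2 * K * |s - τ|)) ≤ _
    rw [Real.exp_neg, ← div_eq_mul_inv, div_le_iff₀ (Real.exp_pos _)]
    calc ‖z s - w s‖ ≤ D + 2 * C * |s - τ| := h1
      _ = D * 1 + C / K * (2 * K * |s - τ|) := by field_simp
      _ ≤ D * Real.exp (2 * K * |s - τ|) + C / K * Real.exp (2 * K * |s - τ|) := by
        gcongr
      _ = _ := by ring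
  set S := ⨆ s, R s with hS
  have hRS : ∀ s, ‖z s - w s‖ ≤ S * Real.exp (2 * K * |s - τ|) := by
    intro s
    have := le_ciSup hRb s
    change ‖z s - w s‖ * Real.exp (-(2 * K * |s - τ|)) ≤ _ at this
    rwa [Real.exp_neg, ← div_eq_mul_inv, div_le_iff₀ (Real.exp_pos _)] at this
  have hS0 : 0 ≤ S := by
    have := (norm_nonneg _).trans (hRS τ)
    simpa using this
  have hS2 : S ≤ D + S / 2 := by
    refine ciSup_le fun s => ?_
    change ‖z s - w s‖ * Real.exp (-(2 * K * |s - τ|)) ≤ _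
    rw [Real.exp_neg, ← div_eq_mul_inv, div_le_iff₀ (Real.exp_pos _)]
    have h3 : 1 ≤ Real.exp (2 * K * |s - τ|) := Real.one_le_exp (by positivity)
    have h4 := hX.norm_integral_sub_le hK hz.continuous hw.continuous hS0 hRS s
    rw [hsplit s]
    refine (norm_add_le _ _).trans ?_
    have : D * 1 ≤ D * Real.exp (2 * K * |s - τ|) := by gcongr
    linarith
  refine (hRS t).trans ?_
  gcongr
  linarith

theorem solution_unique (hX : IsCaratheodoryField X C K) (hK : 0 < K) {z w : ℝ → E}
    (hz : IsCaratheodorySolution X z) (hw : IsCaratheodorySolution X w) {τ : ℝ}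
    (h : z τ = w τ) : z = w := by
  funext t
  have := hX.norm_sub_le hK hz hw τ t
  rw [h, sub_self, norm_zero, mul_zero, zero_mul] at this
  exact sub_eq_zero.1 (norm_le_zero_iff.1 this)

/-- The Picard operator in the weighted variable `exp (-2 K |t - τ|) • z t`. -/
noncomputable def picard (hX : IsCaratheodoryField X C K) (hK : 0 < K) (τ : ℝ) (x : E)
    (W : BoundedContinuousFunction ℝ E) : BoundedContinuousFunction ℝ E :=
  BoundedContinuousFunction.ofNormedAddCommGroup
    (fun t => Real.exp (-(2 * K * |t - τ|)) •
      (x + ∫ s in τ..t, X s (Real.exp (2 * K * |s - τ|) • W s)))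
    (by
      have : Continuous fun t => ∫ s in τ..t, X s (Real.exp (2 * K * |s - τ|) • W s) :=
        intervalIntegral.continuous_primitive
          (fun a b => hX.intervalIntegrable (by fun_prop) a b) τ
      fun_prop)
    (‖x‖ + C / (2 * K))
    (by
      intro t
      have hK' : (0 : ℝ) < K := hK
      have hC : 0 ≤ C := (norm_nonneg _).trans (hX.norm_le 0 0)
      have h1 := hX.norm_integral_le (fun s => Real.exp (2 * K * |s - τ|) • W s) τ t
      have h2 : 2 * K * |t - τ| ≤ Real.exp (2 * K * |t - τ|) := by
        linarith [Real.add_one_le_exp (2 * K * |t - τ|)]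
      have h3 : 1 ≤ Real.exp (2 * K * |t - τ|) := Real.one_le_exp (by positivity)
      rw [norm_smul, Real.norm_of_nonneg (Real.exp_pos _).le, Real.exp_neg, mul_comm,
        ← div_eq_mul_inv, div_le_iff₀ (Real.exp_pos _)]
      calc ‖x + ∫ s in τ..t, X s (Real.exp (2 * K * |s - τ|) • W s)‖
          ≤ ‖x‖ + C * |t - τ| := (norm_add_le _ _).trans (by linarith)
        _ = ‖x‖ * 1 + C / (2 * K) * (2 * K * |t - τ|) := by field_simp
        _ ≤ ‖x‖ * Real.exp (2 * K * |t - τ|) + C / (2 * K) * Real.exp (2 * K * |t - τ|) := by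
          gcongr
        _ = _ := by ring)

theorem contractingWith_picard (hX : IsCaratheodoryField X C K) (hK : 0 < K) (τ : ℝ) (x : E) :
    ContractingWith (1 / 2) (hX.picard hK τ x) := by
  refine ⟨by norm_num, LipschitzWith.of_dist_le_mul fun W V => ?_⟩
  refine (BoundedContinuousFunction.dist_le (by positivity)).2 fun t => ?_
  have h := hX.norm_integral_sub_le hK (z := fun s => Real.exp (2 * K * |s - τ|) • W s)
    (w := fun s => Real.exp (2 * K * |s - τ|) • V s) (by fun_prop) (by fun_prop)
    (S := dist W V) (τ := τ) dist_nonneg (fun s => by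
      rw [← smul_sub, norm_smul, Real.norm_of_nonneg (Real.exp_pos _).le, mul_comm,
        ← dist_eq_norm]
      gcongr
      exact BoundedContinuousFunction.dist_coe_le_dist s) t
  change dist (Real.exp (-(2 * K * |t - τ|)) • (x + _)) (Real.exp (-(2 * K * |t - τ|)) • (x + _)) ≤ _
  rw [dist_eq_norm, ← smul_sub, add_sub_add_left_eq_sub, norm_smul,
    Real.norm_of_nonneg (Real.exp_pos _).le, Real.exp_neg, mul_comm, ← div_eq_mul_inv,
    div_le_iff₀ (Real.exp_pos _)]
  refine h.trans (le_of_eq ?_)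
  push_cast
  ring

theorem exists_solution [CompleteSpace E] (hX : IsCaratheodoryField X C K) (hK : 0 < K) (τ : ℝ)
    (x : E) : ∃ z, IsCaratheodorySolution X z ∧ z τ = x := by
  have hc := hX.contractingWith_picard hK τ x
  set W := ContractingWith.fixedPoint (hX.picard hK τ x) hc
  have hW : hX.picard hK τ x W = W := hc.fixedPoint_isFixedPt
  have hz : ∀ t, Real.exp (2 * K * |t - τ|) • W t =
      x + ∫ s in τ..t, X s (Real.exp (2 * K * |s - τ|) • W s) := by
    intro t
    conv_lhs => rw [← hW]
    change Real.exp (2 * K * |t - τ|) • (Real.exp (-(2 * K * |t - τ|)) • (x + _)) = _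
    rw [smul_smul, ← Real.exp_add, add_neg_cancel, Real.exp_zero, one_smul]
  have hcont : Continuous fun t => Real.exp (2 * K * |t - τ|) • W t := by fun_prop
  refine ⟨fun t => Real.exp (2 * K * |t - τ|) • W t, ⟨hcont, fun a b => ?_⟩, ?_⟩
  · rw [hz a, hz b, add_sub_add_left_eq_sub]
    exact intervalIntegral.integral_interval_sub_left
      (hX.intervalIntegrable hcont _ _) (hX.intervalIntegrable hcont _ _)
  · simp only [hz τ]
    simp

end IsCaratheodoryField

end Caratheodory

/-! ### The inverse of `minkowskiPhi` and the kinetic energy -/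

/-- The inverse `u / √(1 + u²)` of `minkowskiPhi`. -/
noncomputable def minkowskiPsi (u : ℝ) : ℝ := u / √(1 + u ^ 2)

/-- The kinetic energy `√(1 + u²) - 1` in the momentum variable `u = φ(v')`. -/
noncomputable def kineticEnergy (u : ℝ) : ℝ := √(1 + u ^ 2) - 1

theorem one_add_sq_pos (u : ℝ) : 0 < 1 + u ^ 2 := by positivity

theorem sqrt_one_add_sq_pos (u : ℝ) : 0 < √(1 + u ^ 2) := Real.sqrt_pos.2 (one_add_sq_pos u)

theorem sq_sqrt_one_add_sq (u : ℝ) : √(1 + u ^ 2) ^ 2 = 1 + u ^ 2 :=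
  Real.sq_sqrt (one_add_sq_pos u).le

theorem minkowskiPhi_minkowskiPsi (u : ℝ) : minkowskiPhi (minkowskiPsi u) = u := by
  have h1 := sqrt_one_add_sq_pos u
  have h2 := sq_sqrt_one_add_sq u
  have h3 : 1 - (u / √(1 + u ^ 2)) ^ 2 = (1 / √(1 + u ^ 2)) ^ 2 := by
    rw [div_pow, div_pow, h2]
    have := (one_add_sq_pos u).ne'
    field_simp
    ring
  rw [minkowskiPhi, minkowskiPsi, h3, Real.sqrt_sq (by positivity)]
  field_simp

theorem abs_minkowskiPsi_lt_one (u : ℝ) : |minkowskiPsi u| < 1 := by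
  have h1 := sqrt_one_add_sq_pos u
  rw [minkowskiPsi, abs_div, abs_of_pos h1, div_lt_one h1, ← Real.sqrt_sq_eq_abs]
  exact Real.sqrt_lt_sqrt (sq_nonneg u) (by linarith)

theorem minkowskiPsi_pos {u : ℝ} (hu : 0 < u) : 0 < minkowskiPsi u :=
  div_pos hu (sqrt_one_add_sq_pos u)

theorem minkowskiPsi_nonneg {u : ℝ} (hu : 0 ≤ u) : 0 ≤ minkowskiPsi u :=
  div_nonneg hu (sqrt_one_add_sq_pos u).le

theorem minkowskiPsi_nonpos {u : ℝ} (hu : u ≤ 0) : minkowskiPsi u ≤ 0 :=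
  div_nonpos_of_nonpos_of_nonneg hu (sqrt_one_add_sq_pos u).le

@[simp] theorem minkowskiPsi_zero : minkowskiPsi 0 = 0 := by simp [minkowskiPsi]

@[simp] theorem kineticEnergy_zero : kineticEnergy 0 = 0 := by simp [kineticEnergy]

theorem kineticEnergy_nonneg (u : ℝ) : 0 ≤ kineticEnergy u := by
  rw [kineticEnergy, sub_nonneg, Real.one_le_sqrt]
  linarith [sq_nonneg u]

theorem eq_zero_of_kineticEnergy_eq_zero {u : ℝ} (h : kineticEnergy u = 0) : u = 0 := by
  have h2 := sq_sqrt_one_add_sq u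
  rw [sub_eq_zero.1 h] at h2
  have : u ^ 2 = 0 := by linarith
  exact pow_eq_zero_iff (two_ne_zero) |>.1 this

/-- Turns a lower bound on the kinetic energy into a lower bound on the momentum. -/
theorem kineticEnergy_le_self {u : ℝ} (hu : 0 ≤ u) : kineticEnergy u ≤ u := by
  rw [kineticEnergy, sub_le_iff_le_add, Real.sqrt_le_left (by linarith)]
  nlinarith

theorem hasDerivAt_sqrt_one_add_sq (u : ℝ) :
    HasDerivAt (fun u : ℝ => √(1 + u ^ 2)) (minkowskiPsi u) u := by
  have h := (((hasDerivAt_id u).pow 2).const_add 1).sqrt (one_add_sq_pos u).ne'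
  convert! h using 1
  rw [minkowskiPsi]
  have := sqrt_one_add_sq_pos u
  simp
  field_simp

theorem hasDerivAt_kineticEnergy (u : ℝ) : HasDerivAt kineticEnergy (minkowskiPsi u) u :=
  (hasDerivAt_sqrt_one_add_sq u).sub_const 1

theorem hasDerivAt_minkowskiPsi (u : ℝ) :
    HasDerivAt minkowskiPsi (1 / √(1 + u ^ 2) ^ 3) u := by
  have h := (hasDerivAt_id u).div (hasDerivAt_sqrt_one_add_sq u) (sqrt_one_add_sq_pos u).ne'
  convert! h using 1
  have h1 := sqrt_one_add_sq_pos u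
  have h2 := sq_sqrt_one_add_sq u
  rw [minkowskiPsi, id]
  field_simp
  linarith

theorem lipschitzWith_minkowskiPsi : LipschitzWith 1 minkowskiPsi := by
  refine lipschitzWith_of_nnnorm_deriv_le (fun u => (hasDerivAt_minkowskiPsi u).differentiableAt)
    fun u => ?_
  rw [(hasDerivAt_minkowskiPsi u).deriv, ← NNReal.coe_le_coe, coe_nnnorm,
    Real.norm_of_nonneg (by have := sqrt_one_add_sq_pos u; positivity), NNReal.coe_one]
  have : 1 ≤ √(1 + u ^ 2) := by linarith [kineticEnergy_nonneg u, kineticEnergy.eq_def u]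
  exact div_le_one_of_le₀ (one_le_pow₀ this) (by positivity)

theorem continuous_minkowskiPsi : Continuous minkowskiPsi := lipschitzWith_minkowskiPsi.continuous

theorem strictMono_minkowskiPsi : StrictMono minkowskiPsi :=
  strictMono_of_hasDerivAt_pos hasDerivAt_minkowskiPsi
    (fun u => by have := sqrt_one_add_sq_pos u; positivity)

theorem continuous_kineticEnergy : Continuous kineticEnergy :=
  continuous_iff_continuousAt.2 fun u => (hasDerivAt_kineticEnergy u).continuousAt

theorem lipschitzWith_kineticEnergy : LipschitzWith 1 kineticEnergy := by
  refine lipschitzWith_of_nnnorm_deriv_le (fun u => (hasDerivAt_kineticEnergy u).differentiableAt)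
    fun u => ?_
  rw [(hasDerivAt_kineticEnergy u).deriv, ← NNReal.coe_le_coe, coe_nnnorm, Real.norm_eq_abs]
  exact (abs_minkowskiPsi_lt_one u).le

/-- The momentum `u ≥ 0` with given kinetic energy. -/
noncomputable def momentumOfEnergy (y : ℝ) : ℝ := √((1 + y) ^ 2 - 1)

theorem continuous_momentumOfEnergy : Continuous momentumOfEnergy := by
  unfold momentumOfEnergy
  fun_prop

theorem momentumOfEnergy_nonneg (y : ℝ) : 0 ≤ momentumOfEnergy y := Real.sqrt_nonneg _

theorem momentumOfEnergy_pos {y : ℝ} (hy : 0 < y) : 0 < momentumOfEnergy y :=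
  Real.sqrt_pos.2 (by nlinarith)

@[simp] theorem momentumOfEnergy_zero : momentumOfEnergy 0 = 0 := by simp [momentumOfEnergy]

theorem kineticEnergy_momentumOfEnergy {y : ℝ} (hy : 0 ≤ y) :
    kineticEnergy (momentumOfEnergy y) = y := by
  rw [kineticEnergy, momentumOfEnergy, Real.sq_sqrt (by nlinarith), add_sub_cancel,
    Real.sqrt_sq (by linarith)]
  ring

/-! ### The phase-plane system `v' = ψ(u)`, `u' = -h(t, v)` -/

/-- Assumptions on the forcing term of the phase-plane system. -/
structure IsForcing (h : ℝ → ℝ → ℝ) (B : ℝ) (K : ℝ≥0) : Prop where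
  abs_le : ∀ t x, |h t x| ≤ B
  lipschitz : ∀ t, LipschitzWith K (h t)
  aestronglyMeasurable : ∀ v : ℝ → ℝ, Continuous v →
    AEStronglyMeasurable (fun s => h s (v s)) volume

/-- Integral solutions of `v' = ψ(u)`, `u' = -h(t, v)`. -/
structure IsPhaseSolution (h : ℝ → ℝ → ℝ) (v u : ℝ → ℝ) : Prop where
  continuous_fst : Continuous v
  continuous_snd : Continuous u
  sub_fst : ∀ a b, v b - v a = ∫ s in a..b, minkowskiPsi (u s)
  sub_snd : ∀ a b, u b - u a = -∫ s in a..b, h s (v s)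

/-- The right-hand side of the phase-plane system. -/
noncomputable def phaseField (h : ℝ → ℝ → ℝ) (t : ℝ) (p : ℝ × ℝ) : ℝ × ℝ :=
  (minkowskiPsi p.2, -h t p.1)

section Phase

variable {h : ℝ → ℝ → ℝ} {B : ℝ} {K : ℝ≥0} {v u v' u' : ℝ → ℝ}

theorem IsForcing.intervalIntegrable (hh : IsForcing h B K) (hv : Continuous v) (a b : ℝ) :
    IntervalIntegrable (fun s => h s (v s)) volume a b :=
  (intervalIntegrable_const (c := B)).mono_fun (hh.aestronglyMeasurable v hv).restrict
    (ae_of_all _ fun s => (hh.abs_le s _).trans (le_abs_self B))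

/-- In the sup norm of the plane, `ψ` contributes the bound `1` and the Lipschitz constant `1`; the
latter also makes the constant positive, as the contraction argument requires. -/
theorem IsForcing.isCaratheodoryField (hh : IsForcing h B K) :
    IsCaratheodoryField (phaseField h) (max 1 B) (max 1 K) where
  norm_le t z := by
    rw [Prod.norm_def]
    refine max_le_max (abs_minkowskiPsi_lt_one _).le ?_
    simpa [phaseField] using hh.abs_le t z.1
  lipschitz t := by
    have h1 := lipschitzWith_minkowskiPsi.comp (LipschitzWith.prod_snd (α := ℝ) (β := ℝ))
    have h2 := ((hh.lipschitz t).comp (LipschitzWith.prod_fst (α := ℝ) (β := ℝ))).neg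
    simpa using! h1.prodMk h2
  aestronglyMeasurable z hz :=
    (continuous_minkowskiPsi.comp hz.snd).aestronglyMeasurable.prodMk
      (hh.aestronglyMeasurable _ hz.fst).neg

theorem isPhaseSolution_iff (hh : IsForcing h B K) :
    IsPhaseSolution h v u ↔ IsCaratheodorySolution (phaseField h) (fun t => (v t, u t)) := by
  have key : Continuous v → Continuous u → ∀ a b : ℝ,
      ∫ s in a..b, phaseField h s (v s, u s) =
        (∫ s in a..b, minkowskiPsi (u s), -∫ s in a..b, h s (v s)) := by
    intro hv hu a b
    have hi := hh.isCaratheodoryField.intervalIntegrable (hv.prodMk hu) a b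
    refine Prod.ext ?_ ?_
    · exact ((ContinuousLinearMap.fst ℝ ℝ ℝ).intervalIntegral_comp_comm hi).symm
    · rw [← intervalIntegral.integral_neg]
      exact ((ContinuousLinearMap.snd ℝ ℝ ℝ).intervalIntegral_comp_comm hi).symm
  constructor
  · intro H
    refine ⟨H.continuous_fst.prodMk H.continuous_snd, fun a b => ?_⟩
    rw [key H.continuous_fst H.continuous_snd, ← H.sub_fst, ← H.sub_snd]
    rfl
  · intro H
    have hv : Continuous v := H.continuous.fst
    have hu : Continuous u := H.continuous.snd
    have := H.sub_eq_integral
    simp only [key hv hu, Prod.mk_sub_mk, Prod.mk.injEq] at this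
    exact ⟨hv, hu, fun a b => (this a b).1, fun a b => (this a b).2⟩

theorem IsForcing.exists_phaseSolution (hh : IsForcing h B K) (τ x y : ℝ) :
    ∃ v u, IsPhaseSolution h v u ∧ v τ = x ∧ u τ = y := by
  obtain ⟨z, hz, hzτ⟩ := hh.isCaratheodoryField.exists_solution (by simp) τ (x, y)
  refine ⟨fun t => (z t).1, fun t => (z t).2, (isPhaseSolution_iff hh).2 hz, ?_, ?_⟩ <;> simp [hzτ]

namespace IsPhaseSolution

theorem hasDerivAt_fst (H : IsPhaseSolution h v u) (t : ℝ) :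
    HasDerivAt v (minkowskiPsi (u t)) t := by
  have hc : Continuous fun s => minkowskiPsi (u s) :=
    continuous_minkowskiPsi.comp H.continuous_snd
  have h1 : v = fun t => v 0 + ∫ s in (0 : ℝ)..t, minkowskiPsi (u s) := by
    funext s
    rw [← H.sub_fst]
    ring
  rw [h1]
  exact (intervalIntegral.integral_hasDerivAt_right (hc.intervalIntegrable _ _)
    hc.aestronglyMeasurable.stronglyMeasurableAtFilter hc.continuousAt).const_add _

theorem deriv_fst (H : IsPhaseSolution h v u) : deriv v = fun t => minkowskiPsi (u t) :=
  funext fun t => (H.hasDerivAt_fst t).deriv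

theorem contDiff_fst (H : IsPhaseSolution h v u) : ContDiff ℝ 1 v := by
  rw [contDiff_one_iff_deriv, H.deriv_fst]
  exact ⟨fun t => (H.hasDerivAt_fst t).differentiableAt,
    continuous_minkowskiPsi.comp H.continuous_snd⟩

/-- The force is bounded. This is the source of the absolute continuity of `v'` and of the energy.
-/
theorem lipschitzWith_snd (hh : IsForcing h B K) (H : IsPhaseSolution h v u) :
    LipschitzWith B.toNNReal u := by
  refine LipschitzWith.of_dist_le_mul fun a b => ?_
  rw [dist_comm, dist_comm a b, dist_eq_norm, dist_eq_norm, H.sub_snd, norm_neg,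
    Real.coe_toNNReal _ ((abs_nonneg _).trans (hh.abs_le 0 0))]
  exact intervalIntegral.norm_integral_le_of_norm_le_const fun s _ => hh.abs_le s _

theorem ae_hasDerivAt_snd (hh : IsForcing h B K) (H : IsPhaseSolution h v u) :
    ∀ᵐ t, HasDerivAt u (-h t (v t)) t := by
  have hl : LocallyIntegrable (fun s => h s (v s)) volume := by
    refine (locallyIntegrable_const B).mono (hh.aestronglyMeasurable v H.continuous_fst)
      (ae_of_all _ fun s => (hh.abs_le s _).trans (le_abs_self B))
  filter_upwards [LocallyIntegrable.ae_hasDerivAt_integral hl] with t ht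
  have h1 : u = fun t => u 0 + -∫ s in (0 : ℝ)..t, h s (v s) := by
    funext s
    rw [← H.sub_snd]
    ring
  rw [h1]
  exact (ht 0).neg.const_add _

theorem unique (hh : IsForcing h B K) (H : IsPhaseSolution h v u) (H' : IsPhaseSolution h v' u')
    {τ : ℝ} (h1 : v τ = v' τ) (h2 : u τ = u' τ) : v = v' ∧ u = u' := by
  have := hh.isCaratheodoryField.solution_unique (by simp) ((isPhaseSolution_iff hh).1 H)
    ((isPhaseSolution_iff hh).1 H') (τ := τ) (by rw [h1, h2])
  exact ⟨funext fun t => congrArg Prod.fst (congrFun this t),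
    funext fun t => congrArg Prod.snd (congrFun this t)⟩

/-- By uniqueness, a rest state is never reached in finite time; used at the states `0` and `1`. -/
theorem eq_const_of_equilibrium (hh : IsForcing h B K) (H : IsPhaseSolution h v u) {x τ : ℝ}
    (hx : ∀ t, h t x = 0) (h1 : v τ = x) (h2 : u τ = 0) (t : ℝ) : v t = x := by
  have H' : IsPhaseSolution h (fun _ => x) (fun _ => 0) :=
    ⟨continuous_const, continuous_const, by simp, by simp [hx]⟩
  exact congrFun (H.unique hh H' h1 h2).1 t

theorem dist_le (hh : IsForcing h B K) (H : IsPhaseSolution h v u) (H' : IsPhaseSolution h v' u')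
    (τ t : ℝ) : max |v t - v' t| |u t - u' t| ≤
      2 * max |v τ - v' τ| |u τ - u' τ| * Real.exp (2 * max 1 K * |t - τ|) := by
  have := hh.isCaratheodoryField.norm_sub_le (by simp) ((isPhaseSolution_iff hh).1 H)
    ((isPhaseSolution_iff hh).1 H') τ t
  simpa [Prod.norm_def] using this

/-- A family of solutions with continuous initial values is continuous at every time. -/
theorem continuous_of_initial {Y : Type*} [TopologicalSpace Y] {V U : Y → ℝ → ℝ}
    (hh : IsForcing h B K) (H : ∀ x, IsPhaseSolution h (V x) (U x)) {τ : ℝ}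
    (hV : Continuous fun x => V x τ) (hU : Continuous fun x => U x τ) (t : ℝ) :
    Continuous (fun x => V x t) ∧ Continuous (fun x => U x t) := by
  have key : ∀ x₀, Tendsto (fun x => max |V x t - V x₀ t| |U x t - U x₀ t|) (𝓝 x₀) (𝓝 0) := by
    intro x₀
    have h1 : Continuous fun x => 2 * max |V x τ - V x₀ τ| |U x τ - U x₀ τ| *
        Real.exp (2 * max 1 K * |t - τ|) := by fun_prop
    have h2 := h1.tendsto x₀
    simp only [sub_self, abs_zero, max_self, mul_zero, zero_mul] at h2
    exact squeeze_zero (fun x => (abs_nonneg _).trans (le_max_left _ _))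
      (fun x => (H x).dist_le hh (H x₀) τ t) h2
  constructor <;> refine continuous_iff_continuousAt.2 fun x₀ => ?_ <;>
    refine tendsto_iff_dist_tendsto_zero.2 (squeeze_zero (fun _ => dist_nonneg) (fun x => ?_) (key x₀))
  · exact le_max_left _ _
  · exact le_max_right _ _

end IsPhaseSolution

end Phase

/-! ### Energy balance and monotonicity along solutions. -/

namespace IsPhaseSolution

variable {h : ℝ → ℝ → ℝ} {B : ℝ} {K : ℝ≥0} {v u : ℝ → ℝ}

theorem hasDerivAt_energy {Φ φ : ℝ → ℝ} (H : IsPhaseSolution h v u)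
    (hΦ : ∀ x, HasDerivAt Φ (φ x) x) {t : ℝ} (hu : HasDerivAt u (-h t (v t)) t) :
    HasDerivAt (fun s => kineticEnergy (u s) + Φ (v s))
      (minkowskiPsi (u t) * (φ (v t) - h t (v t))) t := by
  have h1 := (hasDerivAt_kineticEnergy (u t)).comp t hu
  have h2 := (hΦ (v t)).comp t (H.hasDerivAt_fst t)
  convert! h1.add h2 using 1
  ring

/-- The energy balance along a solution. -/
theorem energy_sub (hh : IsForcing h B K) (H : IsPhaseSolution h v u) {Φ φ : ℝ → ℝ}
    (hΦ : ∀ x, HasDerivAt Φ (φ x) x) (hφ : Continuous φ) (a b : ℝ) :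
    (kineticEnergy (u b) + Φ (v b)) - (kineticEnergy (u a) + Φ (v a)) =
      ∫ s in a..b, minkowskiPsi (u s) * (φ (v s) - h s (v s)) := by
  -- The momentum is differentiable only almost everywhere, so the fundamental theorem of calculus
  -- rests on absolute continuity.
  have h1 : AbsolutelyContinuousOnInterval (fun s => kineticEnergy (u s)) a b :=
    (lipschitzWith_kineticEnergy.comp (H.lipschitzWith_snd hh)).lipschitzOnWith
      |>.absolutelyContinuousOnInterval
  have hΦ1 : ContDiff ℝ 1 Φ := by
    rw [contDiff_one_iff_deriv, show deriv Φ = φ from funext fun x => (hΦ x).deriv]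
    exact ⟨fun x => (hΦ x).differentiableAt, hφ⟩
  have h2 : AbsolutelyContinuousOnInterval (fun s => Φ (v s)) a b :=
    (hΦ1.comp H.contDiff_fst).contDiffOn.absolutelyContinuousOnInterval
  refine (h1.add h2).integral_deriv_eq_sub.symm.trans ?_
  refine intervalIntegral.integral_congr_ae ?_
  filter_upwards [H.ae_hasDerivAt_snd hh] with t ht _
  exact (H.hasDerivAt_energy hΦ ht).deriv

theorem intervalIntegrable_energy (hh : IsForcing h B K) (H : IsPhaseSolution h v u) {φ : ℝ → ℝ}
    (hφ : Continuous φ) (a b : ℝ) : IntervalIntegrable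
      (fun s => minkowskiPsi (u s) * (φ (v s) - h s (v s))) volume a b :=
  (((hφ.comp H.continuous_fst).intervalIntegrable a b).sub
    (hh.intervalIntegrable H.continuous_fst a b)).continuousOn_mul
      (continuous_minkowskiPsi.comp H.continuous_snd).continuousOn

theorem monotoneOn_fst (H : IsPhaseSolution h v u) {s : Set ℝ} (hs : Convex ℝ s)
    (hu : ∀ t ∈ interior s, 0 ≤ u t) : MonotoneOn v s :=
  monotoneOn_of_deriv_nonneg hs H.continuous_fst.continuousOn
    (fun t _ => (H.hasDerivAt_fst t).differentiableAt.differentiableWithinAt)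
    fun t ht => by rw [H.deriv_fst]; exact minkowskiPsi_nonneg (hu t ht)

theorem antitoneOn_fst (H : IsPhaseSolution h v u) {s : Set ℝ} (hs : Convex ℝ s)
    (hu : ∀ t ∈ interior s, u t ≤ 0) : AntitoneOn v s :=
  antitoneOn_of_deriv_nonpos hs H.continuous_fst.continuousOn
    (fun t _ => (H.hasDerivAt_fst t).differentiableAt.differentiableWithinAt)
    fun t ht => by rw [H.deriv_fst]; exact minkowskiPsi_nonpos (hu t ht)

theorem fst_lt_fst (H : IsPhaseSolution h v u) {a b : ℝ} (hab : a < b)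
    (hu : ∀ t ∈ Icc a b, 0 ≤ u t) (ha : 0 < u a) : v a < v b := by
  rw [← sub_pos, H.sub_fst]
  exact intervalIntegral.integral_pos hab
    (continuous_minkowskiPsi.comp H.continuous_snd).continuousOn
    (fun t ht => minkowskiPsi_nonneg (hu t (Ioc_subset_Icc_self ht)))
    ⟨a, left_mem_Icc.2 hab.le, minkowskiPsi_pos ha⟩

/-- A momentum bounded below gives a speed bounded below, so `v` leaves every bounded interval in
finite time. -/
theorem add_mul_le_fst (H : IsPhaseSolution h v u) {a b ε : ℝ} (hab : a ≤ b)
    (hu : ∀ t ∈ Icc a b, ε ≤ u t) : v a + minkowskiPsi ε * (b - a) ≤ v b := by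
  have h1 : ∫ _ in a..b, minkowskiPsi ε ≤ ∫ s in a..b, minkowskiPsi (u s) :=
    intervalIntegral.integral_mono_on hab (by simp)
      ((continuous_minkowskiPsi.comp H.continuous_snd).intervalIntegrable a b)
      fun t ht => strictMono_minkowskiPsi.monotone (hu t ht)
  rw [← H.sub_fst, intervalIntegral.integral_const, smul_eq_mul] at h1
  linarith

end IsPhaseSolution

/-! ### The left half-line: the unstable curve of `0`. -/

/-- In the region where the forcing is `κ g(v)`, a solution of zero energy starting in the
potential well emanates from the equilibrium `0` at `-∞`. -/
theorem IsPhaseSolution.tendsto_atBot_of_energy_eq_zero {h : ℝ → ℝ → ℝ} {B : ℝ} {K : ℝ≥0}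
    {v u g Φ : ℝ → ℝ} {t₀ κ γ : ℝ} (hh : IsForcing h B K) (H : IsPhaseSolution h v u) (hκ : 0 < κ)
    (hleft : ∀ t ≤ t₀, ∀ x, h t x = κ * g x) (hg : Continuous g)
    (hΦ : ∀ x, HasDerivAt Φ (g x) x) (h0 : ∀ t, h t 0 = 0) (hΦ0 : Φ 0 = 0)
    (hΦneg : ∀ x ∈ Ioo 0 γ, Φ x < 0) (hv : v t₀ ∈ Ioo 0 γ) (hu : 0 < u t₀)
    (hE : kineticEnergy (u t₀) + κ * Φ (v t₀) = 0) :
    (∀ t ≤ t₀, 0 < v t ∧ 0 < u t) ∧ Tendsto v atBot (𝓝 0) := by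
  have henergy : ∀ t ≤ t₀, kineticEnergy (u t) + κ * Φ (v t) = 0 := by
    intro t ht
    have h1 := H.energy_sub hh (Φ := fun x => κ * Φ x) (φ := fun x => κ * g x)
      (fun x => (hΦ x).const_mul κ) (by fun_prop) t t₀
    rw [intervalIntegral.integral_congr (g := fun _ => 0) (fun s hs => by
      rw [uIcc_of_le ht] at hs
      simp [hleft s hs.2]), intervalIntegral.integral_zero] at h1
    linarith
  have hvpos : ∀ t ≤ t₀, 0 < v t := by
    intro t ht
    by_contra! hvt
    obtain ⟨r, hr, hvr⟩ := intermediate_value_Icc ht H.continuous_fst.continuousOn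
      ⟨hvt, hv.1.le⟩
    -- At zero energy `v = 0` forces `u = 0`, so the solution would be the equilibrium.
    have h1 := henergy r hr.2
    rw [hvr, hΦ0, mul_zero, add_zero] at h1
    have := H.eq_const_of_equilibrium hh h0 hvr (eq_zero_of_kineticEnergy_eq_zero h1) t₀
    exact hv.1.ne' this
  have hupos : ∀ t ≤ t₀, 0 < u t := by
    intro t ht
    by_contra! hut
    obtain ⟨r, hr, hur⟩ := intermediate_value_Icc ht H.continuous_snd.continuousOn
      ⟨hut, hu.le⟩
    have hcomp : IsCompact (Icc t t₀ ∩ u ⁻¹' {0}) :=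
      isCompact_Icc.inter_right (isClosed_singleton.preimage H.continuous_snd)
    -- At the last zero `σ` of `u` before `t₀`, `v` still lies inside the well, so the energy there
    -- would be negative.
    obtain ⟨σ, ⟨hσ, hσ0⟩, hmax⟩ := hcomp.exists_isGreatest ⟨r, hr, hur⟩
    have hnn : ∀ s ∈ interior (Icc σ t₀), 0 ≤ u s := by
      intro s hs
      rw [interior_Icc] at hs
      by_contra! hus
      obtain ⟨p, hp, hup⟩ := intermediate_value_Icc hs.2.le H.continuous_snd.continuousOn
        ⟨hus.le, hu.le⟩
      have := hmax ⟨⟨hσ.1.trans (hs.1.le.trans hp.1), hp.2⟩, hup⟩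
      linarith [hs.1, hp.1]
    have hle := H.monotoneOn_fst (convex_Icc σ t₀) hnn (left_mem_Icc.2 hσ.2)
      (right_mem_Icc.2 hσ.2) hσ.2
    have h1 := henergy σ hσ.2
    rw [mem_preimage, mem_singleton_iff] at hσ0
    rw [hσ0, kineticEnergy_zero, zero_add] at h1
    have := mul_neg_of_pos_of_neg hκ (hΦneg (v σ) ⟨hvpos σ hσ.2, hle.trans_lt hv.2⟩)
    linarith
  have hmono : MonotoneOn v (Iic t₀) :=
    H.monotoneOn_fst (convex_Iic t₀) fun t ht => (hupos t (interior_subset (s := Iic t₀) ht)).le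
  refine ⟨fun t ht => ⟨hvpos t ht, hupos t ht⟩, ?_⟩
  -- If `v ≥ ε` for all past times, `Φ(v)` stays below a negative maximum and `u` above a positive
  -- constant; then `v` would reach `0` within a finite time backwards.
  have hsmall : ∀ ε > 0, ∃ t ≤ t₀, v t < ε := by
    intro ε hε
    by_contra! hcon
    have hcont : ContinuousOn Φ (Icc ε (v t₀)) := fun x _ =>
      (hΦ x).continuousAt.continuousWithinAt
    obtain ⟨m, hm, hmmax⟩ := isCompact_Icc.exists_isMaxOn
      ⟨v t₀, hcon t₀ le_rfl, le_rfl⟩ hcont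
    have hΦm : Φ m < 0 := hΦneg m ⟨hε.trans_le hm.1, hm.2.trans_lt hv.2⟩
    have hlow : ∀ t ≤ t₀, κ * -Φ m ≤ u t := by
      intro t ht
      have h1 : Φ (v t) ≤ Φ m :=
        hmmax ⟨hcon t ht, hmono ht (mem_Iic.2 le_rfl) ht⟩
      have h2 := kineticEnergy_le_self (hupos t ht).le
      have h3 := henergy t ht
      have h4 := mul_le_mul_of_nonneg_left h1 hκ.le
      linarith
    have hpsi : 0 < minkowskiPsi (κ * -Φ m) := minkowskiPsi_pos (mul_pos hκ (neg_pos.2 hΦm))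
    have hle : t₀ - v t₀ / minkowskiPsi (κ * -Φ m) ≤ t₀ :=
      sub_le_self _ (div_nonneg hv.1.le hpsi.le)
    have h5 := H.add_mul_le_fst hle fun t ht => hlow t ht.2
    rw [sub_sub_cancel, mul_div_cancel₀ _ hpsi.ne'] at h5
    linarith [hvpos _ hle]
  refine Metric.tendsto_nhds.2 fun ε hε => ?_
  obtain ⟨t, ht, hvt⟩ := hsmall ε hε
  filter_upwards [Iic_mem_atBot t] with s hs
  rw [Real.dist_eq, sub_zero, abs_of_pos (hvpos s (le_trans hs ht))]
  exact (hmono (le_trans hs ht) ht hs).trans_lt hvt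

/-! ### The right half-line: braking, trapping and the modified energy. -/

/-- To the right of `t₀` the forcing is `k(t) g(v)` with `η ≤ k ≤ M` and `g` positive exactly on
`]α, 1[`; the state `1` is an equilibrium. -/
structure IsRightForcing (h : ℝ → ℝ → ℝ) (k g : ℝ → ℝ) (t₀ α η M : ℝ) : Prop where
  eq_mul : ∀ t > t₀, ∀ x, h t x = k t * g x
  eta_pos : 0 < η
  mem_Icc : ∀ t > t₀, k t ∈ Icc η M
  continuous : Continuous g
  nonneg : ∀ x, 0 ≤ g x
  eq_zero : ∀ x, 1 ≤ x → g x = 0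
  pos : ∀ x ∈ Ioo α 1, 0 < g x
  equilibrium : ∀ t, h t 1 = 0

namespace IsRightForcing

variable {h : ℝ → ℝ → ℝ} {B : ℝ} {K : ℝ≥0} {v u k g : ℝ → ℝ} {t₀ α η M : ℝ}

theorem forcing_nonneg (hr : IsRightForcing h k g t₀ α η M) {t : ℝ} (ht : t₀ < t) (x : ℝ) :
    0 ≤ h t x := by
  rw [hr.eq_mul t ht]
  exact mul_nonneg (hr.eta_pos.le.trans (hr.mem_Icc t ht).1) (hr.nonneg x)

theorem antitoneOn_snd (hr : IsRightForcing h k g t₀ α η M) (H : IsPhaseSolution h v u) :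
    AntitoneOn u (Ici t₀) := by
  intro a ha b _ hab
  rw [← sub_nonpos, H.sub_snd, neg_nonpos, intervalIntegral.integral_of_le hab]
  exact setIntegral_nonneg measurableSet_Ioc fun t ht =>
    hr.forcing_nonneg (lt_of_le_of_lt ha ht.1) _

/-- A force bounded below brakes the momentum at a linear rate, so `v` cannot linger where `g` is
bounded away from zero. -/
theorem snd_le_sub_mul (hr : IsRightForcing h k g t₀ α η M) (hh : IsForcing h B K)
    (H : IsPhaseSolution h v u) {a b μ : ℝ} (ha : t₀ ≤ a) (hab : a ≤ b) (hμ : 0 ≤ μ)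
    (hg : ∀ s ∈ Icc a b, μ ≤ g (v s)) : u b ≤ u a - η * μ * (b - a) := by
  have h1 : ∫ _ in Ioc a b, η * μ ≤ ∫ s in Ioc a b, h s (v s) := by
    refine setIntegral_mono_on (intervalIntegrable_const (μ := volume)).1 (hh.intervalIntegrable H.continuous_fst a b).1
      measurableSet_Ioc fun t ht => ?_
    rw [hr.eq_mul t (ha.trans_lt ht.1)]
    have h2 := (hr.mem_Icc t (ha.trans_lt ht.1)).1
    exact mul_le_mul h2 (hg t (Ioc_subset_Icc_self ht)) hμ (hr.eta_pos.le.trans h2)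
  rw [← intervalIntegral.integral_of_le hab, ← intervalIntegral.integral_of_le hab,
    intervalIntegral.integral_const, smul_eq_mul] at h1
  have := H.sub_snd a b
  linarith

/-- A solution reaching `1` keeps a positive velocity. -/
theorem snd_pos_of_one_le (hr : IsRightForcing h k g t₀ α η M) (hh : IsForcing h B K)
    (H : IsPhaseSolution h v u) (hv : v t₀ < 1) (hu : 0 ≤ u t₀) {t : ℝ} (ht : t₀ ≤ t)
    (hvt : 1 ≤ v t) : ∀ s ≥ t₀, 0 < u s := by
  intro s hs
  by_contra! hus
  have hanti := hr.antitoneOn_snd H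
  -- As `u` is nonincreasing, `v` peaks at its zero `σ`, so `v σ ≥ 1`. Beyond the level `1` the
  -- force vanishes, hence `u` was already zero when `v` crossed `1`: rest at an equilibrium,
  -- excluded by uniqueness.
  obtain ⟨σ, hσ, huσ⟩ := intermediate_value_Icc' hs H.continuous_snd.continuousOn ⟨hus, hu⟩
  have hmono : MonotoneOn v (Icc t₀ σ) := H.monotoneOn_fst (convex_Icc _ _) fun r hr' => by
    have hr' := interior_subset hr'
    exact huσ.symm.le.trans (hanti hr'.1 hσ.1 hr'.2)
  have hvσ : 1 ≤ v σ := by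
    rcases le_total t σ with h1 | h1
    · exact hvt.trans (hmono ⟨ht, h1⟩ ⟨hσ.1, le_rfl⟩ h1)
    · refine hvt.trans (H.antitoneOn_fst (convex_Ici σ) (fun r hr' => ?_) (mem_Ici.2 le_rfl)
        (mem_Ici.2 h1) h1)
      have hr' : σ ≤ r := interior_subset (s := Ici σ) hr'
      exact (hanti hσ.1 (hσ.1.trans hr') hr').trans huσ.le
  obtain ⟨r, hrm, hvr⟩ := intermediate_value_Icc hσ.1 H.continuous_fst.continuousOn ⟨hv.le, hvσ⟩
  have hur : u r = 0 := by
    have h1 := H.sub_snd r σ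
    rw [intervalIntegral.integral_of_le hrm.2, setIntegral_congr_fun (g := fun _ => (0 : ℝ))
      measurableSet_Ioc (fun p hp => ?_), integral_zero] at h1
    · linarith
    · have h2 : v r ≤ v p := hmono hrm ⟨hrm.1.trans hp.1.le, hp.2⟩ hp.1.le
      simp only
      rw [hr.eq_mul p (hrm.1.trans_lt hp.1), hr.eq_zero _ (hvr ▸ h2), mul_zero]
  exact hv.ne (H.eq_const_of_equilibrium hh hr.equilibrium hvr hur t₀)

/-- A solution trapped in `[α, 1]` with nonnegative velocity is increasing and converges
to `(1, 0)`. -/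
theorem tendsto_of_le_one (hr : IsRightForcing h k g t₀ α η M) (hh : IsForcing h B K)
    (H : IsPhaseSolution h v u) (hv : v t₀ ∈ Ico α 1) (hu₀ : 0 < u t₀)
    (hu : ∀ t ≥ t₀, 0 ≤ u t) (hv1 : ∀ t ≥ t₀, v t ≤ 1) :
    (∀ t ≥ t₀, 0 < u t ∧ v t < 1) ∧ (∀ t > t₀, α < v t) ∧ Tendsto v atTop (𝓝 1) ∧
      Tendsto u atTop (𝓝 0) := by
  have hanti := hr.antitoneOn_snd H
  have hmono : MonotoneOn v (Ici t₀) := H.monotoneOn_fst (convex_Ici t₀) fun t ht =>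
    hu t (interior_subset (s := Ici t₀) ht)
  have hlt : ∀ t ≥ t₀, v t < 1 := by
    intro t ht
    by_contra! hvt
    have hpos := hr.snd_pos_of_one_le hh H hv.2 hu₀.le ht hvt
    have := H.fst_lt_fst (lt_add_one t) (fun s hs => hu s (ht.trans hs.1)) (hpos t ht)
    linarith [hv1 (t + 1) (by linarith)]
  have hα : ∀ t > t₀, α < v t := fun t ht =>
    hv.1.trans_lt (H.fst_lt_fst ht (fun s hs => hu s hs.1) hu₀)
  -- Otherwise `v` stays in the compact interval `[v t, y]`, where `g` has a positive minimum, and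
  -- braking makes `u` negative. Strict `t > t₀` matters: `v t₀` may be `α`, where `g` need not be
  -- positive.
  have hdrift : ∀ t > t₀, ∀ y < 1, ∃ s ≥ t, y < v s := by
    intro t ht y hy
    by_contra! hcon
    obtain ⟨m, hm, hmin⟩ := isCompact_Icc.exists_isMinOn ⟨v t, le_rfl, hcon t le_rfl⟩
      hr.continuous.continuousOn
    have hgm : 0 < g m := hr.pos m ⟨(hα t ht).trans_le hm.1, hm.2.trans_lt hy⟩
    have hηg := mul_pos hr.eta_pos hgm
    -- The time needed for `u` to fall to `-1`.
    have hle : t ≤ t + (u t + 1) / (η * g m) :=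
      le_add_of_nonneg_right (div_nonneg (by linarith [hu t ht.le]) hηg.le)
    have h1 := hr.snd_le_sub_mul hh H ht.le hle hgm.le fun s hs =>
      hmin ⟨hmono ht.le (ht.le.trans hs.1) hs.1, hcon s hs.1⟩
    rw [add_sub_cancel_left, mul_div_cancel₀ _ hηg.ne'] at h1
    linarith [hu _ (ht.le.trans hle)]
  have hupos : ∀ t ≥ t₀, 0 < u t := by
    intro t ht
    refine (hu t ht).lt_of_ne fun h0 => ?_
    have ht' : t₀ < t := lt_of_le_of_ne ht fun h => by rw [h] at hu₀; exact hu₀.ne h0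
    obtain ⟨s, hs, hvs⟩ := hdrift t ht' (v t) (hlt t ht)
    have := H.antitoneOn_fst (convex_Ici t) (fun r hr' => by
      have hr' : t ≤ r := interior_subset (s := Ici t) hr'
      exact h0 ▸ hanti ht (le_trans ht hr') hr') (mem_Ici.2 le_rfl) hs hs
    linarith
  refine ⟨fun t ht => ⟨hupos t ht, hlt t ht⟩, hα, ?_, ?_⟩
  · refine Metric.tendsto_nhds.2 fun ε hε => ?_
    obtain ⟨s, hs, hvs⟩ := hdrift (t₀ + 1) (by linarith) (1 - ε) (by linarith)
    have hs₀ : t₀ ≤ s := by linarith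
    filter_upwards [Ici_mem_atTop s] with t ht
    have h1 := hmono hs₀ (le_trans hs₀ ht) ht
    have h2 := hlt t (le_trans hs₀ ht)
    rw [Real.dist_eq, abs_of_neg (by linarith)]
    linarith
  · refine Metric.tendsto_nhds.2 fun ε hε => ?_
    obtain ⟨s, hs, hus⟩ : ∃ s ≥ t₀, u s < ε := by
      by_contra! hcon
      have hpsi := minkowskiPsi_pos hε
      have hle : t₀ ≤ t₀ + (1 - v t₀) / minkowskiPsi ε :=
        le_add_of_nonneg_right (div_nonneg (by linarith [hv.2]) hpsi.le)
      have h1 := H.add_mul_le_fst hle fun t ht => hcon t ht.1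
      rw [add_sub_cancel_left, mul_div_cancel₀ _ hpsi.ne'] at h1
      linarith [hlt _ hle]
    filter_upwards [Ici_mem_atTop s] with t ht
    rw [Real.dist_eq, sub_zero, abs_of_pos (hupos t (le_trans hs ht))]
    exact (hanti hs (le_trans hs ht) ht).trans_lt hus

theorem energy_integrand_nonneg (hr : IsRightForcing h k g t₀ α η M) {t : ℝ} (ht : t₀ < t)
    (hu : 0 ≤ u t) : 0 ≤ minkowskiPsi (u t) * (M * g (v t) - h t (v t)) := by
  rw [hr.eq_mul t ht, ← sub_mul]
  exact mul_nonneg (minkowskiPsi_nonneg hu)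
    (mul_nonneg (sub_nonneg.2 (hr.mem_Icc t ht).2) (hr.nonneg _))

/-- With the potential weighted by the maximum `M` of `k`, the energy has derivative `ψ(u) (M - k)
g(v) ≥ 0`; hence the supremum norm in (∗). -/
theorem energy_mono (hr : IsRightForcing h k g t₀ α η M) (hh : IsForcing h B K)
    (H : IsPhaseSolution h v u) {Γ : ℝ → ℝ} (hΓ : ∀ x, HasDerivAt Γ (g x) x) {a b : ℝ}
    (ha : t₀ ≤ a) (hab : a ≤ b) (hu : ∀ t ∈ Icc a b, 0 ≤ u t) :
    kineticEnergy (u a) + M * Γ (v a) ≤ kineticEnergy (u b) + M * Γ (v b) := by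
  have hg := hr.continuous
  rw [← sub_nonneg, H.energy_sub hh (Φ := fun x => M * Γ x) (φ := fun x => M * g x)
    (fun x => (hΓ x).const_mul M) (by fun_prop), intervalIntegral.integral_of_le hab]
  exact setIntegral_nonneg measurableSet_Ioc fun t ht =>
    hr.energy_integrand_nonneg (ha.trans_lt ht.1) (hu t (Ioc_subset_Icc_self ht))

theorem potential_lt (hr : IsRightForcing h k g t₀ α η M) {Γ : ℝ → ℝ}
    (hΓ : ∀ x, HasDerivAt Γ (g x) x) {x : ℝ} (hx : x ∈ Ico α 1) : Γ x < Γ 1 := by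
  have : StrictMonoOn Γ (Icc α 1) := strictMonoOn_of_deriv_pos (convex_Icc _ _)
    (fun y _ => (hΓ y).continuousAt.continuousWithinAt) fun y hy => by
      rw [interior_Icc] at hy
      rw [(hΓ y).deriv]
      exact hr.pos y hy
  exact this (Ico_subset_Icc_self hx) (right_mem_Icc.2 (hx.1.trans hx.2.le)) hx.2

/-- With enough initial energy the velocity never changes sign. -/
theorem snd_nonneg_of_energy (hr : IsRightForcing h k g t₀ α η M) (hh : IsForcing h B K)
    (H : IsPhaseSolution h v u) {Γ : ℝ → ℝ} (hΓ : ∀ x, HasDerivAt Γ (g x) x)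
    (hM : 0 < M) (hv : v t₀ ∈ Ico α 1) (hu : 0 ≤ u t₀)
    (hE : M * Γ 1 ≤ kineticEnergy (u t₀) + M * Γ (v t₀)) : ∀ t ≥ t₀, 0 ≤ u t := by
  intro t ht
  by_contra! hut
  have hanti := hr.antitoneOn_snd H
  obtain ⟨σ, hσ, huσ⟩ := intermediate_value_Icc' ht H.continuous_snd.continuousOn ⟨hut.le, hu⟩
  have hnn : ∀ s ∈ Icc t₀ σ, 0 ≤ u s := fun s hs => huσ ▸ hanti hs.1 hσ.1 hs.2
  have h1 := hr.energy_mono hh H hΓ le_rfl hσ.1 hnn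
  -- At a turning point all energy is potential, so `Γ(v σ) ≥ Γ(1)` forces `v σ ≥ 1`, where the
  -- momentum cannot vanish.
  rw [huσ, kineticEnergy_zero, zero_add] at h1
  have h2 : Γ 1 ≤ Γ (v σ) := le_of_mul_le_mul_left (hE.trans h1) hM
  have h3 : v t₀ ≤ v σ := H.monotoneOn_fst (convex_Icc t₀ σ)
    (fun s hs => hnn s (interior_subset hs)) (left_mem_Icc.2 hσ.1) (right_mem_Icc.2 hσ.1) hσ.1
  have h4 : 1 ≤ v σ := by
    by_contra! h5
    exact h2.not_gt (hr.potential_lt hΓ ⟨hv.1.trans h3, h5⟩)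
  exact (hr.snd_pos_of_one_le hh H hv.2 hu hσ.1 h4 σ hσ.1).ne' huσ

/-- If a solution with at least the critical initial energy converges to `(1, 0)`, then its
energy is critical and `k` is almost everywhere maximal. -/
theorem rigidity (hr : IsRightForcing h k g t₀ α η M) (hh : IsForcing h B K)
    (H : IsPhaseSolution h v u) {Γ : ℝ → ℝ} (hΓ : ∀ x, HasDerivAt Γ (g x) x)
    (hu : ∀ t ≥ t₀, 0 < u t ∧ v t < 1) (hα : ∀ t > t₀, α < v t)
    (hv1 : Tendsto v atTop (𝓝 1)) (hu0 : Tendsto u atTop (𝓝 0))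
    (hE : M * Γ 1 ≤ kineticEnergy (u t₀) + M * Γ (v t₀)) :
    kineticEnergy (u t₀) + M * Γ (v t₀) = M * Γ 1 ∧
      ∀ᵐ t ∂(volume.restrict (Ioi t₀)), k t = M := by
  have hg := hr.continuous
  set W : ℝ → ℝ := fun t => kineticEnergy (u t) + M * Γ (v t) with hW
  have hlim : Tendsto W atTop (𝓝 (M * Γ 1)) := by
    have h1 := (continuous_kineticEnergy.tendsto 0).comp hu0
    have h2 := ((hΓ 1).continuousAt.tendsto.comp hv1).const_mul M
    simpa using h1.add h2
  have hWmono : ∀ a b, t₀ ≤ a → a ≤ b → W a ≤ W b := fun a b ha hab =>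
    hr.energy_mono hh H hΓ ha hab fun t ht => (hu t (ha.trans ht.1)).1.le
  have hWle : ∀ t ≥ t₀, W t ≤ M * Γ 1 := fun t ht =>
    ge_of_tendsto hlim (by filter_upwards [Ici_mem_atTop t] with s hs using hWmono t s ht hs)
  have hWeq : ∀ t ≥ t₀, W t = M * Γ 1 := fun t ht =>
    (hWle t ht).antisymm (hE.trans (hWmono t₀ t le_rfl ht))
  refine ⟨hWeq t₀ le_rfl, ?_⟩
  -- Constant energy makes the nonnegative power integrand vanish almost everywhere; its factors
  -- `ψ(u)` and `g(v)` are positive, so `k = M`. Bounded intervals suffice, by countable union.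
  have hae : ∀ n : ℕ, ∀ᵐ t ∂(volume.restrict (Ioc t₀ (t₀ + n))), k t = M := by
    intro n
    have hle : t₀ ≤ t₀ + n := by simp
    have h1 := H.energy_sub hh (Φ := fun x => M * Γ x) (φ := fun x => M * g x)
      (fun x => (hΓ x).const_mul M) (by fun_prop) t₀ (t₀ + n)
    have h2 : W (t₀ + n) - W t₀ = 0 := by rw [hWeq _ hle, hWeq _ le_rfl, sub_self]
    rw [show _ = (0 : ℝ) from h2, intervalIntegral.integral_of_le hle] at h1
    have h3 := (setIntegral_eq_zero_iff_of_nonneg_ae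
      (by
        filter_upwards [ae_restrict_mem measurableSet_Ioc] with t ht
        exact hr.energy_integrand_nonneg ht.1 (hu t ht.1.le).1.le)
      (H.intervalIntegrable_energy hh (φ := fun x => M * g x) (by fun_prop) t₀ (t₀ + n)).1).1
        h1.symm
    filter_upwards [h3, ae_restrict_mem measurableSet_Ioc] with t ht htm
    simp only [Pi.zero_apply] at ht
    rw [hr.eq_mul t htm.1, ← sub_mul] at ht
    have h4 := minkowskiPsi_pos (hu t htm.1.le).1
    have h5 := hr.pos (v t) ⟨hα t htm.1, (hu t htm.1.le).2⟩
    rcases mul_eq_zero.1 ht with h6 | h6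
    · exact absurd h6 h4.ne'
    · rcases mul_eq_zero.1 h6 with h7 | h7
      · linarith
      · exact absurd h7 h5.ne'
  have hU : Ioi t₀ = ⋃ n : ℕ, Ioc t₀ (t₀ + n) := by
    ext t
    simp only [mem_Ioi, mem_iUnion, mem_Ioc]
    refine ⟨fun ht => ?_, fun ⟨n, hn⟩ => hn.1⟩
    obtain ⟨n, hn⟩ := exists_nat_ge (t - t₀)
    exact ⟨n, ht, by linarith⟩
  rw [hU, ae_restrict_iUnion_iff]
  exact hae

end IsRightForcing

/-! ### Shooting. -/

/-- Shooting along the zero-energy curve `kineticEnergy u + κ Φ(v) = 0`: some initial value in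
`[α, γ[` gives a solution which stays below `1` and never turns back. -/
theorem IsRightForcing.exists_trapped {h : ℝ → ℝ → ℝ} {B : ℝ} {K : ℝ≥0} {k g Φ Γ : ℝ → ℝ}
    {t₀ α γ η M κ : ℝ} (hr : IsRightForcing h k g t₀ α η M) (hh : IsForcing h B K)
    (hκ : 0 < κ) (hM : 0 < M) (hαγ : α < γ) (hγ1 : γ < 1) (hΦ : Continuous Φ) (hΦγ : Φ γ = 0)
    (hΦneg : ∀ x ∈ Ico α γ, Φ x < 0) (hΓ : ∀ x, HasDerivAt Γ (g x) x)
    (hE : M * Γ 1 ≤ -(κ * Φ α) + M * Γ α) :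
    ∃ v u, IsPhaseSolution h v u ∧ v t₀ ∈ Ico α γ ∧ 0 < u t₀ ∧
      kineticEnergy (u t₀) + κ * Φ (v t₀) = 0 ∧ ∀ t ≥ t₀, 0 ≤ u t ∧ v t ≤ 1 := by
  -- The family is indexed by all real `x`. Off `[α, γ]`, where the square root may take its default
  -- value, only continuity and nonnegativity of the initial momentum matter.
  choose V U H hV hU using fun x : ℝ =>
    hh.exists_phaseSolution t₀ x (momentumOfEnergy (-(κ * Φ x)))
  have hcont : ∀ t, Continuous (fun x => V x t) ∧ Continuous (fun x => U x t) := by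
    refine IsPhaseSolution.continuous_of_initial hh H (τ := t₀) ?_ ?_
    · simp only [hV]
      exact continuous_id
    · simp only [hU]
      exact continuous_momentumOfEnergy.comp (by fun_prop)
  have hU0 : ∀ x, 0 ≤ U x t₀ := fun x => by rw [hU]; exact momentumOfEnergy_nonneg _
  have hUE : ∀ x ∈ Ico α γ, kineticEnergy (U x t₀) = -(κ * Φ x) := fun x hx => by
    rw [hU, kineticEnergy_momentumOfEnergy]
    exact (neg_pos.2 (mul_neg_of_pos_of_neg hκ (hΦneg x hx))).le
  set S : Set ℝ := {x | ∃ t ≥ t₀, U x t < 0} with hS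
  have hSopen : IsOpen S := by
    have : S = ⋃ t ≥ t₀, {x | U x t < 0} := by
      ext x
      simp [hS]
    rw [this]
    exact isOpen_biUnion fun t _ => isOpen_lt (hcont t).2 continuous_const
  have hαS : α ∉ S := by
    rintro ⟨t, ht, hut⟩
    refine (hr.snd_nonneg_of_energy hh (H α) hΓ hM ?_ (hU0 α) ?_ t ht).not_gt hut
    · rw [hV]
      exact ⟨le_rfl, hαγ.trans hγ1⟩
    · rw [hV, hUE α ⟨le_rfl, hαγ⟩]
      exact hE
  -- At `γ` the initial momentum is `0`. Without turning back `v` would be constantly `γ`, but `g γ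
  -- > 0` makes the momentum negative.
  have hγS : γ ∈ S := by
    by_contra hcon
    have hnn : ∀ t ≥ t₀, 0 ≤ U γ t := by
      intro t ht
      by_contra! hlt
      exact hcon ⟨t, ht, hlt⟩
    have hu0 : U γ t₀ = 0 := by rw [hU, hΦγ, mul_zero, neg_zero, momentumOfEnergy_zero]
    have hgγ : 0 < g γ := hr.pos γ ⟨hαγ, hγ1⟩
    have hanti : AntitoneOn (V γ) (Ici t₀) := (H γ).antitoneOn_fst (convex_Ici t₀) fun t ht => by
      have ht : t₀ ≤ t := interior_subset (s := Ici t₀) ht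
      exact hu0 ▸ hr.antitoneOn_snd (H γ) (mem_Ici.2 le_rfl) ht ht
    have hmono : MonotoneOn (V γ) (Ici t₀) := (H γ).monotoneOn_fst (convex_Ici t₀) fun t ht =>
      hnn t (interior_subset (s := Ici t₀) ht)
    have h1 := hr.snd_le_sub_mul hh (H γ) le_rfl (lt_add_one t₀).le hgγ.le fun s hs => by
      rw [(hanti (mem_Ici.2 le_rfl) hs.1 hs.1).antisymm (hmono (mem_Ici.2 le_rfl) hs.1 hs.1), hV]
    have h2 := hnn (t₀ + 1) (by linarith)
    have h3 := mul_pos hr.eta_pos hgγ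
    rw [hu0] at h1
    linarith
  obtain ⟨x, ⟨hx, hxS⟩, hmax⟩ := (isCompact_Icc.inter_right hSopen.isClosed_compl).exists_isGreatest
    (⟨α, ⟨le_rfl, hαγ.le⟩, hαS⟩ : (Icc α γ ∩ Sᶜ).Nonempty)
  have hxγ : x < γ := lt_of_le_of_ne hx.2 fun h => hxS (h ▸ hγS)
  refine ⟨V x, U x, H x, ?_, ?_, ?_, fun t ht => ⟨?_, ?_⟩⟩
  · rw [hV]
    exact ⟨hx.1, hxγ⟩
  · rw [hU]
    exact momentumOfEnergy_pos (neg_pos.2 (mul_neg_of_pos_of_neg hκ (hΦneg x ⟨hx.1, hxγ⟩)))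
  · rw [hUE x ⟨hx.1, hxγ⟩, hV]
    ring
  · by_contra! hlt
    exact hxS ⟨t, ht, hlt⟩
  · by_contra! hgt
    -- Overshooting persists for `y` slightly above `x`. By maximality of `x` these `y` turn back,
    -- which a solution that has reached `1` cannot do.
    have h1 : ∀ᶠ y in 𝓝[>] x, 1 < V y t :=
      ((hcont t).1.tendsto x).eventually (lt_mem_nhds hgt) |>.filter_mono nhdsWithin_le_nhds
    obtain ⟨y, hy1, hy⟩ := (h1.and (Ioo_mem_nhdsGT hxγ)).exists
    have hyS : y ∈ S := by
      by_contra hcon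
      exact (hmax ⟨⟨hx.1.trans hy.1.le, hy.2.le⟩, hcon⟩).not_gt hy.1
    obtain ⟨s, hs, hus⟩ := hyS
    exact (hr.snd_pos_of_one_le hh (H y) (by rw [hV]; exact hy.2.trans hγ1) (hU0 y) ht hy1.le
      s hs).not_gt hus

/-! ### Truncated nonlinearity and its potentials. -/

/-- The extension of `f|_[a,1]` to the real line by its boundary values. -/
noncomputable def clampExtend (f : ℝ → ℝ) (a x : ℝ) : ℝ := f (max a (min x 1))

section ClampExtend

variable {f : ℝ → ℝ} {L : ℝ≥0} {a : ℝ}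

theorem clampExtend_of_mem {x : ℝ} (hx : x ∈ Icc a 1) : clampExtend f a x = f x := by
  rw [clampExtend, min_eq_left hx.2, max_eq_right hx.1]

theorem clamp_mem (ha : a ≤ 1) (x : ℝ) : max a (min x 1) ∈ Icc a 1 :=
  ⟨le_max_left _ _, max_le ha (min_le_right _ _)⟩

theorem lipschitzWith_clampExtend (hf : LipschitzOnWith L f (Icc 0 1)) (ha : a ∈ Icc (0 : ℝ) 1) :
    LipschitzWith L (clampExtend f a) := by
  have h1 : LipschitzWith 1 fun x : ℝ => max a (min x 1) :=
    (LipschitzWith.id.min_const 1).const_max a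
  have h2 := hf.comp (s := univ) (h1.lipschitzOnWith) fun x _ =>
    Icc_subset_Icc_left ha.1 (clamp_mem ha.2 x)
  rw [mul_one, lipschitzOnWith_univ] at h2
  exact h2

theorem abs_clampExtend_le (hf : LipschitzOnWith L f (Icc 0 1)) (hf0 : f 0 = 0)
    (ha : a ∈ Icc (0 : ℝ) 1) (x : ℝ) : |clampExtend f a x| ≤ L := by
  have hm := Icc_subset_Icc_left ha.1 (clamp_mem ha.2 x)
  have h1 := hf.dist_le_mul _ hm 0 (by simp)
  rw [hf0, Real.dist_eq, Real.dist_eq, sub_zero, sub_zero, abs_of_nonneg hm.1] at h1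
  exact h1.trans (mul_le_of_le_one_right L.2 hm.2)

theorem hasDerivAt_integral_clampExtend (hf : LipschitzOnWith L f (Icc 0 1))
    (ha : a ∈ Icc (0 : ℝ) 1) (b x : ℝ) :
    HasDerivAt (fun x => ∫ s in b..x, clampExtend f a s) (clampExtend f a x) x :=
  have hc := (lipschitzWith_clampExtend hf ha).continuous
  intervalIntegral.integral_hasDerivAt_right (hc.intervalIntegrable _ _)
    hc.aestronglyMeasurable.stronglyMeasurableAtFilter hc.continuousAt

theorem primitiveF_eq_integral_clampExtend {x : ℝ} (hx : x ∈ Icc (0 : ℝ) 1) :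
    primitiveF f x = ∫ s in (0 : ℝ)..x, clampExtend f 0 s := by
  refine intervalIntegral.integral_congr fun s hs => ?_
  rw [uIcc_of_le hx.1] at hs
  exact (clampExtend_of_mem ⟨hs.1, hs.2.trans hx.2⟩).symm

theorem integral_clampExtend_one (hf : LipschitzOnWith L f (Icc 0 1)) (ha : a ∈ Icc (0 : ℝ) 1) :
    ∫ s in a..1, clampExtend f a s = primitiveF f 1 - primitiveF f a := by
  have hc := (lipschitzWith_clampExtend hf (a := 0) (by simp)).continuous
  rw [primitiveF_eq_integral_clampExtend (x := 1) (by simp), primitiveF_eq_integral_clampExtend ha,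
    intervalIntegral.integral_interval_sub_left (hc.intervalIntegrable _ _)
      (hc.intervalIntegrable _ _)]
  refine intervalIntegral.integral_congr fun s hs => ?_
  rw [uIcc_of_le ha.2] at hs
  rw [clampExtend_of_mem hs, clampExtend_of_mem ⟨ha.1.trans hs.1, hs.2⟩]

end ClampExtend

/-- The potential well of a bistable nonlinearity. -/
theorem exists_zero_primitive_of_isBistable {f : ℝ → ℝ} {L : ℝ≥0} {α : ℝ}
    (hfL : LipschitzOnWith L f (Icc 0 1)) (hf : IsBistable f α) (hF : 0 < primitiveF f 1) :
    ∃ γ ∈ Ioo α 1, primitiveF f γ = 0 ∧ ∀ x ∈ Ioo 0 γ, primitiveF f x < 0 := by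
  have hα := hf.alpha_mem
  set Φ : ℝ → ℝ := fun x => ∫ s in (0 : ℝ)..x, clampExtend f 0 s with hΦdef
  have hΦ : ∀ x, HasDerivAt Φ (clampExtend f 0 x) x :=
    hasDerivAt_integral_clampExtend hfL (by simp) 0
  have hΦF : ∀ x ∈ Icc (0 : ℝ) 1, primitiveF f x = Φ x := fun x hx =>
    primitiveF_eq_integral_clampExtend hx
  have hΦc : Continuous Φ := continuous_iff_continuousAt.2 fun x => (hΦ x).continuousAt
  have hΦ0 : Φ 0 = 0 := by simp [hΦdef]
  have hanti : StrictAntiOn Φ (Icc 0 α) := strictAntiOn_of_deriv_neg (convex_Icc _ _)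
    hΦc.continuousOn fun y hy => by
      rw [interior_Icc] at hy
      rw [(hΦ y).deriv, clampExtend_of_mem ⟨hy.1.le, hy.2.le.trans hα.2.le⟩]
      exact hf.neg y hy
  have hmono : StrictMonoOn Φ (Icc α 1) := strictMonoOn_of_deriv_pos (convex_Icc _ _)
    hΦc.continuousOn fun y hy => by
      rw [interior_Icc] at hy
      rw [(hΦ y).deriv, clampExtend_of_mem ⟨hα.1.le.trans hy.1.le, hy.2.le⟩]
      exact hf.pos y hy
  have hneg : ∀ x ∈ Ioc 0 α, Φ x < 0 := fun x hx =>
    hΦ0 ▸ hanti (left_mem_Icc.2 hα.1.le) (Ioc_subset_Icc_self hx) hx.1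
  rw [hΦF 1 (by simp)] at hF
  have hΦα := hneg α ⟨hα.1, le_rfl⟩
  obtain ⟨γ, hγ, hΦγ⟩ := intermediate_value_Ioo hα.2.le hΦc.continuousOn ⟨hΦα, hF⟩
  refine ⟨γ, hγ, ?_, fun x hx => ?_⟩
  · rw [hΦF γ ⟨hα.1.le.trans hγ.1.le, hγ.2.le⟩, hΦγ]
  · rw [hΦF x ⟨hx.1.le, hx.2.le.trans hγ.2.le⟩]
    rcases le_total x α with h1 | h1
    · exact hneg x ⟨hx.1, h1⟩
    · exact hΦγ ▸ hmono ⟨h1, hx.2.le.trans hγ.2.le⟩ (Ioo_subset_Icc_self hγ) hx.2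

/-! ### The forcing built from the weight and the nonlinearity. -/

/-- A weight in `L^∞(t₀, ∞)` bounded below has a measurable representative with values between the
lower bound and the essential supremum. -/
theorem exists_measurable_representative {q : ℝ → ℝ} {t₀ η : ℝ}
    (hq : MemLp q ∞ (volume.restrict (Ioi t₀)))
    (hqη : ∀ᵐ t ∂(volume.restrict (Ioi t₀)), η ≤ q t) :
    η ≤ linftyNormRight q t₀ ∧ ∃ Q : ℝ → ℝ, Measurable Q ∧
      (∀ t, Q t ∈ Icc η (linftyNormRight q t₀)) ∧
      ∀ᵐ t ∂(volume.restrict (Ioi t₀)), q t = Q t := by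
  have hle : ∀ᵐ t ∂(volume.restrict (Ioi t₀)), q t ≤ linftyNormRight q t₀ := by
    have h1 := ae_le_eLpNormEssSup (f := q) (μ := volume.restrict (Ioi t₀))
    filter_upwards [h1] with t ht
    rw [← eLpNorm_exponent_top] at ht
    have h2 := ENNReal.toReal_mono hq.2.ne ht
    rw [toReal_enorm] at h2
    exact (le_abs_self _).trans h2
  have hne : (ae (volume.restrict (Ioi t₀))).NeBot := by
    rw [ae_neBot, Ne, Measure.restrict_eq_zero]
    simp
  have hηM : η ≤ linftyNormRight q t₀ := by
    obtain ⟨t, h1, h2⟩ := (hqη.and hle).exists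
    exact h1.trans h2
  -- Clamping makes the bounds hold at every time and alters `q` on `]t₀, +∞[` only on a null set.
  refine ⟨hηM, fun t => max η (min (hq.1.mk q t) (linftyNormRight q t₀)), ?_, fun t => ?_, ?_⟩
  · exact measurable_const.max (hq.1.stronglyMeasurable_mk.measurable.min measurable_const)
  · exact ⟨le_max_left _ _, max_le hηM (min_le_right _ _)⟩
  · filter_upwards [hle, hqη, hq.1.ae_eq_mk] with t h1 h2 h3
    rw [← h3, min_eq_left h1, max_eq_right h2]

/-- The forcing term of the extended problem: `c f / δ` up to `t₀`, and `Q f / δ` with `f` cut off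
below `α` afterwards. -/
noncomputable def shootingForcing (δ t₀ c α : ℝ) (Q f : ℝ → ℝ) (t x : ℝ) : ℝ :=
  if t ≤ t₀ then c / δ * clampExtend f 0 x else Q t / δ * clampExtend f α x

theorem isForcing_shootingForcing {δ t₀ c α M : ℝ} {Q f : ℝ → ℝ} {L : ℝ≥0} (hδ : 0 < δ)
    (hc : 0 ≤ c) (hQm : Measurable Q) (hQ : ∀ t, Q t ∈ Icc 0 M)
    (hfL : LipschitzOnWith L f (Icc 0 1)) (hf0 : f 0 = 0) (hα : α ∈ Icc (0 : ℝ) 1) :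
    IsForcing (shootingForcing δ t₀ c α Q f) ((c + M) / δ * L)
      (((c + M) / δ).toNNReal * L) := by
  have hM : 0 ≤ M := (hQ 0).1.trans (hQ 0).2
  have h0 : (0 : ℝ) ∈ Icc (0 : ℝ) 1 := by simp
  have hcb : |c / δ| ≤ (c + M) / δ := by
    rw [abs_of_nonneg (by positivity)]
    gcongr
    linarith
  have hQb : ∀ t, |Q t / δ| ≤ (c + M) / δ := fun t => by
    rw [abs_of_nonneg (div_nonneg (hQ t).1 hδ.le)]
    gcongr
    linarith [(hQ t).2]
  have hcM : 0 ≤ (c + M) / δ := by positivity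
  refine ⟨fun t x => ?_, fun t => LipschitzWith.of_dist_le_mul fun x y => ?_, fun v hv => ?_⟩
  · rw [shootingForcing]
    split_ifs
    · rw [abs_mul]
      exact mul_le_mul hcb (abs_clampExtend_le hfL hf0 h0 x) (abs_nonneg _) hcM
    · rw [abs_mul]
      exact mul_le_mul (hQb t) (abs_clampExtend_le hfL hf0 hα x) (abs_nonneg _) hcM
  · rw [shootingForcing, shootingForcing, NNReal.coe_mul, Real.coe_toNNReal _ hcM, mul_assoc]
    split_ifs
    · rw [Real.dist_eq, ← mul_sub, abs_mul]
      exact mul_le_mul hcb ((lipschitzWith_clampExtend hfL h0).dist_le_mul x y) (abs_nonneg _) hcM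
    · rw [Real.dist_eq, ← mul_sub, abs_mul]
      exact mul_le_mul (hQb t) ((lipschitzWith_clampExtend hfL hα).dist_le_mul x y)
        (abs_nonneg _) hcM
  · have h1 : Measurable fun s => clampExtend f 0 (v s) :=
      ((lipschitzWith_clampExtend hfL h0).continuous.comp hv).measurable
    have h2 : Measurable fun s => clampExtend f α (v s) :=
      ((lipschitzWith_clampExtend hfL hα).continuous.comp hv).measurable
    exact (Measurable.ite measurableSet_Iic (h1.const_mul _)
      ((hQm.div_const δ).mul h2)).aestronglyMeasurable

theorem isRightForcing_shootingForcing {δ t₀ c α η M : ℝ} {Q f : ℝ → ℝ} {L : ℝ≥0} (hδ : 0 < δ)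
    (hη : 0 < η) (hQ : ∀ t, Q t ∈ Icc η M) (hfL : LipschitzOnWith L f (Icc 0 1))
    (hf : IsBistable f α) :
    IsRightForcing (shootingForcing δ t₀ c α Q f) (fun t => Q t / δ) (clampExtend f α) t₀ α
      (η / δ) (M / δ) where
  eq_mul t ht x := if_neg ht.not_ge
  eta_pos := by positivity
  mem_Icc t _ := ⟨by gcongr; exact (hQ t).1, by gcongr; exact (hQ t).2⟩
  continuous := (lipschitzWith_clampExtend hfL (Ioo_subset_Icc_self hf.alpha_mem)).continuous
  nonneg x := by
    have h1 := clamp_mem hf.alpha_mem.2.le x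
    rw [clampExtend]
    rcases h1.1.eq_or_lt with h2 | h2
    · rw [← h2, hf.zero_alpha]
    · rcases h1.2.eq_or_lt with h3 | h3
      · rw [h3, hf.zero_right]
      · exact (hf.pos _ ⟨h2, h3⟩).le
  eq_zero x hx := by
    rw [clampExtend, min_eq_right hx, max_eq_right hf.alpha_mem.2.le, hf.zero_right]
  pos x hx := by
    rw [clampExtend_of_mem (Ioo_subset_Icc_self hx)]
    exact hf.pos x hx
  equilibrium t := by
    rw [shootingForcing, clampExtend_of_mem (by simp),
      clampExtend_of_mem ⟨hf.alpha_mem.2.le, le_rfl⟩, hf.zero_right]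
    simp

/-! ### Return to the original equation. -/

/-- A phase solution with values in `[0, 1]` solves the original equation. -/
theorem IsPhaseSolution.isMinkowskiSolution {h : ℝ → ℝ → ℝ} {B δ : ℝ} {K : ℝ≥0}
    {v u q f : ℝ → ℝ} (hh : IsForcing h B K) (H : IsPhaseSolution h v u)
    (hv : ∀ t, v t ∈ Icc (0 : ℝ) 1) (heq : ∀ᵐ t, δ * h t (v t) = q t * f (v t)) :
    IsMinkowskiSolution δ q f v where
  mem_Icc := hv
  contDiff := H.contDiff_fst
  abs_deriv_lt_one t := by
    rw [H.deriv_fst]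
    exact abs_minkowskiPsi_lt_one _
  absolutelyContinuous_deriv a b := by
    rw [H.deriv_fst]
    exact (lipschitzWith_minkowskiPsi.comp
      (H.lipschitzWith_snd hh)).lipschitzOnWith.absolutelyContinuousOnInterval
  equation := by
    simp only [H.deriv_fst, minkowskiPhi_minkowskiPsi]
    filter_upwards [H.ae_hasDerivAt_snd hh, heq] with t h1 h2
    refine ⟨h1.differentiableAt, ?_⟩
    change δ * deriv u t + _ = 0
    rw [h1.deriv]
    linarith

theorem mainTheorem2 (δ t₀ η c α : ℝ) (q f : ℝ → ℝ) (L : ℝ≥0)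
    (hδ : 0 < δ)
    (hq : MemLp q ∞ (volume.restrict (Ioi t₀)))
    (hη : 0 < η) (hqη : ∀ᵐ t ∂(volume.restrict (Ioi t₀)), η ≤ q t)
    (hc : 0 < c) (hqc : ∀ᵐ t ∂(volume.restrict (Iic t₀)), q t = c)
    (hfL : LipschitzOnWith L f (Icc 0 1))
    (hf : IsBistable f α)
    (hF : 0 < primitiveF f 1)
    (hcond : linftyNormRight q t₀ *
      ((primitiveF f 1 - primitiveF f α) / (-primitiveF f α)) ≤ c) :
    ∃ v : ℝ → ℝ, IsHeteroclinicSolution δ q f v ∧ v t₀ ∈ Ico α 1 ∧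
      (¬ (c = linftyNormRight q t₀ *
            ((primitiveF f 1 - primitiveF f α) / (-primitiveF f α)) ∧
          ∀ᵐ t ∂(volume.restrict (Ioi t₀)), q t = linftyNormRight q t₀) →
        v t₀ ∈ Ioo α 1) := by
  obtain ⟨hηM, Q, hQm, hQ, hqQ⟩ := exists_measurable_representative hq hqη
  set M := linftyNormRight q t₀ with hMdef
  have hM : 0 < M := hη.trans_le hηM
  have hα := hf.alpha_mem
  have hα' : α ∈ Icc (0 : ℝ) 1 := Ioo_subset_Icc_self hα
  have h0 : (0 : ℝ) ∈ Icc (0 : ℝ) 1 := by simp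
  obtain ⟨γ, hγ, hFγ, hFneg⟩ := exists_zero_primitive_of_isBistable hfL hf hF
  have hFα : primitiveF f α < 0 := hFneg α ⟨hα.1, hγ.1⟩
  have hh := isForcing_shootingForcing (t₀ := t₀) hδ hc.le hQm
    (fun t => ⟨hη.le.trans (hQ t).1, (hQ t).2⟩) hfL hf.zero_left hα'
  have hr := isRightForcing_shootingForcing (t₀ := t₀) (c := c) hδ hη hQ hfL hf
  set h := shootingForcing δ t₀ c α Q f with hhdef
  set Φ : ℝ → ℝ := fun x => ∫ s in (0 : ℝ)..x, clampExtend f 0 s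
  have hΦ : ∀ x, HasDerivAt Φ (clampExtend f 0 x) x :=
    hasDerivAt_integral_clampExtend hfL h0 0
  have hΦF : ∀ x ∈ Icc (0 : ℝ) 1, primitiveF f x = Φ x := fun x hx =>
    primitiveF_eq_integral_clampExtend hx
  have hΦneg : ∀ x ∈ Ioo 0 γ, Φ x < 0 := fun x hx =>
    hΦF x ⟨hx.1.le, hx.2.le.trans hγ.2.le⟩ ▸ hFneg x hx
  set Γ : ℝ → ℝ := fun x => ∫ s in α..x, clampExtend f α s
  have hΓ : ∀ x, HasDerivAt Γ (clampExtend f α x) x :=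
    hasDerivAt_integral_clampExtend hfL hα' α
  have hΓ1 : Γ 1 = primitiveF f 1 - primitiveF f α := integral_clampExtend_one hfL hα'
  have hΓα : Γ α = 0 := intervalIntegral.integral_same
  have hcond' : M * (primitiveF f 1 - primitiveF f α) ≤ c * -primitiveF f α := by
    rwa [← mul_div_assoc, div_le_iff₀ (neg_pos.2 hFα)] at hcond
  -- Condition (∗) with denominators cleared: on the zero-energy curve the kinetic energy at `α` is
  -- `-(c/δ) F(α)`.
  have hE : M / δ * Γ 1 ≤ -(c / δ * Φ α) + M / δ * Γ α := by
    rw [hΓ1, hΓα, ← hΦF α hα', mul_zero, add_zero, ← mul_neg, div_mul_eq_mul_div,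
      div_mul_eq_mul_div]
    gcongr
  have hκ : 0 < c / δ := by positivity
  obtain ⟨v, u, H, hv₀, hu₀, hE₀, htrap⟩ := hr.exists_trapped hh hκ (by positivity) hγ.1 hγ.2
    (continuous_iff_continuousAt.2 fun x => (hΦ x).continuousAt)
    ((hΦF γ ⟨hα.1.le.trans hγ.1.le, hγ.2.le⟩).symm.trans hFγ)
    (fun x hx => hΦneg x ⟨hα.1.trans_le hx.1, hx.2⟩) hΓ hE
  have hv₁ : v t₀ ∈ Ico α 1 := ⟨hv₀.1, hv₀.2.trans hγ.2⟩
  -- After `t₀` the cutoff sends `0` to `α`, which is also a zero of `f`, so `0` remains an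
  -- equilibrium.
  have hequil : ∀ t, h t 0 = 0 := fun t => by
    rw [hhdef, shootingForcing, clampExtend_of_mem h0, clampExtend, min_eq_left zero_le_one,
      max_eq_left hα.1.le, hf.zero_alpha, hf.zero_left]
    simp
  obtain ⟨hleft, hbot⟩ := H.tendsto_atBot_of_energy_eq_zero hh hκ (g := clampExtend f 0)
    (fun t ht x => if_pos ht) (lipschitzWith_clampExtend hfL h0).continuous hΦ hequil
    intervalIntegral.integral_same hΦneg ⟨hα.1.trans_le hv₀.1, hv₀.2⟩ hu₀ hE₀
  obtain ⟨hright, hgtα, htop, hutop⟩ := hr.tendsto_of_le_one hh H hv₁ hu₀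
    (fun t ht => (htrap t ht).1) (fun t ht => (htrap t ht).2)
  have hupos : ∀ t, 0 < u t := fun t =>
    (le_total t t₀).elim (fun ht => (hleft t ht).2) fun ht => (hright t ht).1
  have hmono : StrictMono v := strictMono_of_hasDerivAt_pos H.hasDerivAt_fst
    fun t => minkowskiPsi_pos (hupos t)
  have hv01 : ∀ t, v t ∈ Icc (0 : ℝ) 1 := fun t =>
    (le_total t t₀).elim
      (fun ht => ⟨(hleft t ht).1.le, (hmono.monotone ht).trans hv₁.2.le⟩)
      fun ht => ⟨hα.1.le.trans (hv₁.1.trans (hmono.monotone ht)), (hright t ht).2.le⟩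
  -- The truncations are inactive: `v` lies in `[0, 1]`, and above `α` after `t₀`.
  have heq : ∀ᵐ t, δ * h t (v t) = q t * f (v t) := by
    rw [ae_restrict_iff' measurableSet_Ioi] at hqQ
    rw [ae_restrict_iff' measurableSet_Iic] at hqc
    filter_upwards [hqQ, hqc] with t h1 h2
    rcases le_or_gt t t₀ with ht | ht
    · rw [hhdef, shootingForcing, if_pos ht, clampExtend_of_mem (hv01 t), h2 ht]
      field_simp
    · rw [hr.eq_mul t ht, clampExtend_of_mem ⟨(hgtα t ht).le, (hv01 t).2⟩, h1 ht]
      field_simp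
  refine ⟨v, ⟨H.isMinkowskiSolution hh hv01 heq, hmono, hbot, htop⟩, hv₁, fun hne => ?_⟩
  refine ⟨lt_of_le_of_ne hv₁.1 fun hαv => hne ?_, hv₁.2⟩
  rw [← hαv] at hE₀
  -- If `v t₀ = α`, the modified energy is supercritical by (∗) while the solution converges to
  -- `(1,0)`, so both exceptional conditions hold.
  obtain ⟨h1, h2⟩ := hr.rigidity hh H hΓ hright hgtα htop hutop (by rw [← hαv]; linarith)
  rw [← hαv, hΓα, mul_zero, add_zero, hΓ1] at h1
  rw [← hΦF α hα', h1] at hE₀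
  constructor
  · rw [← mul_div_assoc, eq_div_iff (neg_pos.2 hFα).ne']
    field_simp at hE₀
    linarith
  · filter_upwards [h2, hqQ] with t h3 h4
    rw [h4]
    exact (div_left_inj' hδ.ne').1 h3
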